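/- Conventions. For a group $G$ and a conjugacy class $c$ of $G$, let $N^{cy}(G)$ be the cyclic bar construction: the cyclic set with $N^{cy}(G)_p=G^{p+1}$, faces $\partial_i(g_0,\dots,g_p)=(g_0,\dots,g_ig_{i+1},\dots,g_p)$ for $i<p$ and $\partial_p(g_0,\dots,g_p)=(g_pg_0,g_1,\dots,g_{p-1})$, degeneracies $s_j$ inserting $1$ after $g_j$, and cyclic operators $t_p(g_0,\dots,g_p)=(g_p,g_0,\dots,g_{p-1})$. Let $N^{cy}(G)_c\subset N^{cy}(G)$ be the cyclic subset of all tuples with $g_0g_1\cdots g_p\in c$, so that $N^{cy}(G)=\coprod_c N^{cy}(G)_c$. For a group $C$ and a central element $z\in C$, let $B(C,z)$ be the nerve $BC$ with the cyclic operators $t_p[a_1,\dots,a_p]=[z(a_1\cdots a_p)^{-1},a_1,\dots,a_{p-1}]$. For $c\neq\langle 1\rangle$ let $C_c$ be the group of families $(a_y)_{y\in c}$ with $a_y$ in the centralizer $C_y$ of $y$ and $a_{h^{-1}yh}=h^{-1}a_yh$ for all $y\in c$, $h\in G$; let $C_{\langle1\rangle}=G$. The family $(y)_{y\in c}$ (the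 element $1$ if $c=\langle 1\rangle$) is a central element of $C_c$, and $BC_c$ denotes $B(C_c,(y)_{y\in c})$. If $G$ and $H$ are free groups, a homomorphism $f:G\to H$ induces a unique homomorphism $C_c\to C_{f(c)}$ whose components are the restrictions $C_y\to C_{f(y)}$ of $f$; in this way $G\mapsto\coprod_cBC_c$ is a functor $f\mapsto f_*$ from free groups to cyclic sets, as is $G\mapsto N^{cy}(G)$. A map $X\to Y$ of simplicial sets is a weak equivalence if it induces a bijection $[Y,K]\to[X,K]$ of homotopy classes for every Kan complex $K$. Statement. Let $\Gamma_\bullet$ be a simplicial group with every $\Gamma_n$ free, so that $[n]\mapsto\coprod_{c}BC_{c}$ and $[n]\mapsto N^{cy}(\Gamma_n)$ (with $c$ running through the conjugacy classes of $\Gamma_n$) are simplicial objects in cyclic sets. (1) For every $n$, every conjugacy class $c$ of $\Gamma_n$ and every $y\in c$, the evaluation $a\mapsto a_y$ is an isomorphism of $C_c$ onto the centralizer $C_y$. If $c\ne\langle1\rangle$, there is a unique $r\in C_c$ such that, for every $y\in c$, the element $r_y$ generates $C_y$ and $y$ is a positive power of $r_y$. (2) Choose for every $n$ and every conjugacy class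 $c$ of $\Gamma_n$ an element $b_c\in c$. For each $n$, the formula $[a_1,\dots,a_p]\mapsto((\bar a_1\cdots \bar a_p)^{-1}b_c,\bar a_1,\dots,\bar a_p)$, where $\bar a_i=(a_i)_{b_c}$, defines injective maps of cyclic sets $BC_c\hookrightarrow N^{cy}(\Gamma_n)_c$ and hence an injective map of cyclic sets $$F_n:\coprod_{c}BC_{c}\longrightarrow\coprod_{c}N^{cy}(\Gamma_n)_{c}=N^{cy}(\Gamma_n).$$ Each map $BC_c\to N^{cy}(\Gamma_n)_c$, and each $F_n$, is a weak equivalence. (3) For every simplicial operator $\lambda:\Gamma_n\to\Gamma_m$, the maps $\lambda_*\circ F_n$ and $F_m\circ\lambda_*$ from $\coprod_cBC_c$ to $N^{cy}(\Gamma_m)$ are homotopic by a canonical homotopy. Precisely, there are families $(h_c)$ of elements of $\Gamma_m$, indexed by the conjugacy classes of $\Gamma_n$, with $h_c^{-1}\lambda(b_c)h_c=b_{\lambda(c)}$ and $h_{\langle 1\rangle}=1$, and for each such family there is a homotopy from $\lambda_*\circ F_n$ to $F_m\circ\lambda_*$ which on the summand $BC_c$ is $\lambda_*\circ F_n$ followed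 by the standard homotopy from the identity of $N^{cy}(\Gamma_m)$ to conjugation $(g_i)\mapsto(h_c^{-1}g_ih_c)$. For $h\in\Gamma_m$, this standard homotopy sends a $p$-simplex $((g_0,\dots,g_p),s)$ of $N^{cy}(\Gamma_m)\times\Delta[1]$, $s:[p]\to[1]$, to the tuple $(k_{i-1}^{-1}g_ik_i)_{0\le i\le p}$, where $k_i=1$ if $s(i)=0$, $k_i=h$ if $s(i)=1$, and $k_{-1}=k_p$. (4) The maps $F_n$ are natural in the same sense: for every morphism $f:\Gamma_\bullet\to\Gamma'_\bullet$ of degreewise free simplicial groups, all choices of elements in the conjugacy classes of the $\Gamma_n$ and of the $\Gamma'_n$, and every $n$, the assertion of (3) holds for $f_n:\Gamma_n\to\Gamma'_n$, with $F_n$ for $\Gamma_\bullet$ and $F_n$ for $\Gamma'_\bullet$, in place of $\lambda$, $F_n$ and $F_m$. (For $f=\mathrm{id}$: up to canonical homotopy, $F_n$ does not depend on the choices.) -/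

import Mathlib

universe u
open CategoryTheory Opposite Simplicial MonoidalCategory

namespace FreeGroupFacts

lemma subsingleton_of_central {X : Type u} (w : FreeGroup X) (hw : w ≠ 1)
    (hc : ∀ s : X, FreeGroup.of s * w = w * FreeGroup.of s) : ∃ x : X, ∀ s : X, s = x := by
  classical
  rcases hL : w.toWord with _ | ⟨⟨x, e⟩, L⟩
  · exact absurd (FreeGroup.toWord_eq_nil_iff.mp hL) hw
  refine ⟨x, fun s => ?_⟩
  by_contra hne
  have h1 : (FreeGroup.of s * w).toWord = (s, true) :: w.toWord := by
    rw [FreeGroup.toWord_mul, FreeGroup.toWord_of, List.singleton_append,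
      FreeGroup.reduce.cons, FreeGroup.reduce_toWord, hL]
    simp [hne]
  have h2 : (w * FreeGroup.of s).toWord.Sublist (w.toWord ++ [(s, true)]) := by
    simpa using FreeGroup.toWord_mul_sublist w (FreeGroup.of s)
  rw [← hc, h1] at h2
  have h3 := h2.eq_of_length (by simp)
  rw [hL] at h3
  simp only [List.cons_append, List.cons.injEq, Prod.mk.injEq] at h3
  exact hne h3.1.1

/-- In a free group the centralizer of a nontrivial element is cyclic. -/
lemma exists_generator_centralizer {G : Type u} [Group G] [IsFreeGroup G] {y : G} (hy : y ≠ 1) :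
    ∃ r : G, ∀ a : G, a * y = y * a → ∃ k : ℤ, a = r ^ k := by
  let K : Subgroup G := Subgroup.centralizer {y}
  let e : K ≃* FreeGroup (IsFreeGroup.Generators K) := IsFreeGroup.toFreeGroup K
  have hyK : y ∈ K := by simp [K, Subgroup.mem_centralizer_iff]
  have hne : e ⟨y, hyK⟩ ≠ 1 := by
    intro h
    have := (map_eq_one_iff e e.injective).mp h
    exact hy (congrArg Subtype.val this)
  obtain ⟨x, hx⟩ := subsingleton_of_central (e ⟨y, hyK⟩) hne (by
    intro s
    obtain ⟨k, hk⟩ := e.surjective (FreeGroup.of s)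
    rw [← hk, ← map_mul, ← map_mul]
    congr 1
    apply Subtype.ext
    have := Subgroup.mem_centralizer_iff.mp k.2 y rfl
    simpa using this.symm)
  have hz : ∀ w : FreeGroup (IsFreeGroup.Generators K), ∃ k : ℤ, w = FreeGroup.of x ^ k := by
    intro w
    have hw : w ∈ Subgroup.zpowers (FreeGroup.of x) := by
      have htop : w ∈ Subgroup.closure (Set.range (FreeGroup.of (α := IsFreeGroup.Generators K))) := by
        rw [FreeGroup.closure_range_of]; trivial
      refine (Subgroup.closure_le _).mpr ?_ htop
      rintro _ ⟨s, rfl⟩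
      rw [hx s]
      exact Subgroup.mem_zpowers _
    obtain ⟨k, hk⟩ := Subgroup.mem_zpowers_iff.mp hw
    exact ⟨k, hk.symm⟩
  refine ⟨(e.symm (FreeGroup.of x) : K), fun a ha => ?_⟩
  have haK : a ∈ K := by
    simp only [K, Subgroup.mem_centralizer_iff, Set.mem_singleton_iff, forall_eq]
    exact ha.symm
  obtain ⟨k, hk⟩ := hz (e ⟨a, haK⟩)
  refine ⟨k, ?_⟩
  have : (⟨a, haK⟩ : K) = e.symm (FreeGroup.of x) ^ k := by
    rw [← map_zpow, ← hk, e.symm_apply_apply]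
  simpa using congrArg Subtype.val this

lemma commute_of_commute {G : Type u} [Group G] [IsFreeGroup G] {y : G} (hy : y ≠ 1) {a b : G}
    (ha : a * y = y * a) (hb : b * y = y * b) : a * b = b * a := by
  obtain ⟨r, hr⟩ := exists_generator_centralizer hy
  obtain ⟨k, rfl⟩ := hr a ha
  obtain ⟨l, rfl⟩ := hr b hb
  rw [← zpow_add, ← zpow_add, add_comm]

lemma map_eq_one {G H : Type u} [Group G] [Group H] [IsFreeGroup G] [IsFreeGroup H] (f : G →* H)
    {y a : G} (hy : y ≠ 1) (ha : a * y = y * a) (hf : f y = 1) : f a = 1 := by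
  have : IsMulTorsionFree H :=
    Function.Injective.isMulTorsionFree (IsFreeGroup.toFreeGroup H).toMonoidHom
      (IsFreeGroup.toFreeGroup H).injective
  obtain ⟨r, hr⟩ := exists_generator_centralizer hy
  obtain ⟨k, hk⟩ := hr y rfl
  obtain ⟨l, rfl⟩ := hr a ha
  have hk0 : k ≠ 0 := by
    rintro rfl
    exact hy (by simpa using hk)
  have : f r ^ k = 1 := by rw [← map_zpow, ← hk, hf]
  have hr1 : f r = 1 := by
    exact zpow_left_injective hk0 (by simpa using this)
  rw [map_zpow, hr1, one_zpow]

end FreeGroupFacts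
/-- A cyclic set: a simplicial set with operators `t n` on its `n`-simplices satisfying the
relations of Connes' cyclic category. -/
structure CyclicSet where
  toSSet : SSet.{u}
  t (n : ℕ) : toSSet _⦋n⦌ → toSSet _⦋n⦌
  t_iterate (n : ℕ) (x : toSSet _⦋n⦌) : (t n)^[n + 1] x = x
  δ_zero_t (n : ℕ) (x : toSSet _⦋n + 1⦌) :
    toSSet.δ 0 (t (n + 1) x) = toSSet.δ (Fin.last (n + 1)) x
  δ_succ_t (n : ℕ) (i : Fin (n + 1)) (x : toSSet _⦋n + 1⦌) :
    toSSet.δ i.succ (t (n + 1) x) = t n (toSSet.δ i.castSucc x)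
  σ_zero_t (n : ℕ) (x : toSSet _⦋n⦌) :
    toSSet.σ 0 (t n x) = t (n + 1) (t (n + 1) (toSSet.σ (Fin.last n) x))
  σ_succ_t (n : ℕ) (i : Fin n) (x : toSSet _⦋n⦌) :
    toSSet.σ i.succ (t n x) = t (n + 1) (toSSet.σ i.castSucc x)

namespace CyclicSet

/-- A map of cyclic sets: a simplicial map commuting with the cyclic operators. -/
@[ext]
structure Hom (X Y : CyclicSet.{u}) where
  toSSetHom : X.toSSet ⟶ Y.toSSet
  comm (n : ℕ) (x : X.toSSet _⦋n⦌) :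
    toSSetHom.app (op ⦋n⦌) (X.t n x) = Y.t n (toSSetHom.app (op ⦋n⦌) x)

instance : Category CyclicSet.{u} where
  Hom X Y := Hom X Y
  id X := { toSSetHom := 𝟙 _, comm := fun _ _ => rfl }
  comp f g :=
    { toSSetHom := f.toSSetHom ≫ g.toSSetHom
      comm := fun n x => by
        simp only [SSet.comp_app, comp_apply, f.comm, g.comm] }

@[ext]
lemma hom_ext {X Y : CyclicSet.{u}} {f g : X ⟶ Y} (h : f.toSSetHom = g.toSSetHom) : f = g :=
  Hom.ext h

/-- The disjoint union of a family of cyclic sets. -/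
def sigma {ι : Type u} (X : ι → CyclicSet.{u}) : CyclicSet.{u} where
  toSSet :=
    { obj := fun n => Σ i, (X i).toSSet.obj n
      map := fun α => ↾fun x => ⟨x.1, (X x.1).toSSet.map α x.2⟩
      map_id := fun n => by
        refine ConcreteCategory.hom_ext _ _ fun x => ?_
        exact congrArg (Sigma.mk x.1) (ConcreteCategory.congr_hom ((X x.1).toSSet.map_id n) x.2)
      map_comp := fun α β => by
        refine ConcreteCategory.hom_ext _ _ fun x => ?_
        exact congrArg (Sigma.mk x.1)
          (ConcreteCategory.congr_hom ((X x.1).toSSet.map_comp α β) x.2) }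
  t n x := ⟨x.1, (X x.1).t n x.2⟩
  t_iterate n x := by
    obtain ⟨i, x⟩ := x
    have h : ∀ k : ℕ, (fun x : Σ i, (X i).toSSet _⦋n⦌ => (⟨x.1, (X x.1).t n x.2⟩ :
        Σ i, (X i).toSSet _⦋n⦌))^[k] ⟨i, x⟩ = ⟨i, ((X i).t n)^[k] x⟩ := by
      intro k
      induction k with
      | zero => rfl
      | succ k ih => rw [Function.iterate_succ_apply', ih, Function.iterate_succ_apply']
    exact (h (n + 1)).trans (by rw [(X i).t_iterate])
  δ_zero_t n x := congrArg (Sigma.mk x.1) ((X x.1).δ_zero_t n x.2)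
  δ_succ_t n i x := congrArg (Sigma.mk x.1) ((X x.1).δ_succ_t n i x.2)
  σ_zero_t n x := congrArg (Sigma.mk x.1) ((X x.1).σ_zero_t n x.2)
  σ_succ_t n i x := congrArg (Sigma.mk x.1) ((X x.1).σ_succ_t n i x.2)

/-- The map of disjoint unions given by a map `f` of index sets and maps of summands. -/
def sigmaMap {ι κ : Type u} {X : ι → CyclicSet.{u}} {Y : κ → CyclicSet.{u}} (f : ι → κ)
    (g : ∀ i, X i ⟶ Y (f i)) : sigma X ⟶ sigma Y where
  toSSetHom :=
    { app := fun n => ↾fun x => ⟨f x.1, (g x.1).toSSetHom.app n x.2⟩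
      naturality := fun m n α => by
        ext x
        exact congrArg (Sigma.mk (f x.1))
          (ConcreteCategory.congr_hom ((g x.1).toSSetHom.naturality α) x.2) }
  comm n x := congrArg (Sigma.mk (f x.1)) ((g x.1).comm n x.2)

/-- The map out of a disjoint union given by maps on the summands. -/
def sigmaDesc {ι : Type u} {X : ι → CyclicSet.{u}} {Y : CyclicSet.{u}}
    (g : ∀ i, X i ⟶ Y) : sigma X ⟶ Y where
  toSSetHom :=
    { app := fun n => ↾fun x => (g x.1).toSSetHom.app n x.2
      naturality := fun m n α => by
        ext x
        exact ConcreteCategory.congr_hom ((g x.1).toSSetHom.naturality α) x.2 }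
  comm n x := (g x.1).comm n x.2

/-- The cyclic structure on a simplicial set induced by an embedding into a cyclic set whose
image is stable under the cyclic operators. -/
def ofEmbedding (Y : CyclicSet.{u}) (X : SSet.{u}) (f : X ⟶ Y.toSSet)
    (hf : ∀ n : ℕ, Function.Injective (f.app (op ⦋n⦌)))
    (t : ∀ n : ℕ, X _⦋n⦌ → X _⦋n⦌)
    (ht : ∀ (n : ℕ) (x : X _⦋n⦌), f.app (op ⦋n⦌) (t n x) = Y.t n (f.app (op ⦋n⦌) x)) :
    CyclicSet.{u} where
  toSSet := X
  t := t
  t_iterate n x := by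
    have h : Function.Semiconj (f.app (op ⦋n⦌)) (t n) (Y.t n) := ht n
    exact hf n ((h.iterate_right (n + 1) x).trans (Y.t_iterate n _))
  δ_zero_t n x := hf n (by
    rw [SSet.δ_naturality_apply, SSet.δ_naturality_apply, ht, Y.δ_zero_t])
  δ_succ_t n i x := hf n (by
    rw [ht, SSet.δ_naturality_apply, SSet.δ_naturality_apply, ht, Y.δ_succ_t])
  σ_zero_t n x := hf (n + 1) (by
    rw [ht, ht, SSet.σ_naturality_apply, SSet.σ_naturality_apply, ht, Y.σ_zero_t])
  σ_succ_t n i x := hf (n + 1) (by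
    rw [ht, SSet.σ_naturality_apply, SSet.σ_naturality_apply, ht, Y.σ_succ_t])

end CyclicSet

section WeakEquivalence

/-- The set `[X, K]` of simplicial homotopy classes of maps. -/
def HomotopyClasses (X K : SSet.{u}) : Type u :=
  Quot fun f g : X ⟶ K => Nonempty (SSet.Homotopy f g)

/-- The map `[Y, K] → [X, K]` induced by `f : X ⟶ Y`. -/
def HomotopyClasses.precomp {X Y : SSet.{u}} (f : X ⟶ Y) (K : SSet.{u}) :
    HomotopyClasses Y K → HomotopyClasses X K :=
  Quot.map (fun g => f ≫ g) (by
    rintro g g' ⟨h⟩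
    exact ⟨{ h := f ▷ _ ≫ h.h
             h₀ := by
              show SSet.ι₀ ≫ f ▷ _ ≫ h.h = f ≫ g
              rw [SSet.ι₀_comp_assoc, h.h₀]
             h₁ := by
              show SSet.ι₁ ≫ f ▷ _ ≫ h.h = f ≫ g'
              rw [SSet.ι₁_comp_assoc, h.h₁]
             rel := by ext _ ⟨⟨_, ⟨⟩⟩, _⟩ }⟩)

/-- A map `f : X ⟶ Y` of simplicial sets is a weak (homotopy) equivalence if for every Kan complex
`K` it induces a bijection `[Y, K] → [X, K]`. -/
def IsWeakEquivalence {X Y : SSet.{u}} (f : X ⟶ Y) : Prop :=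
  ∀ K : SSet.{u}, SSet.KanComplex K → Function.Bijective (HomotopyClasses.precomp f K)

end WeakEquivalence
namespace CyclicNerve

/-- The cyclic operator `(g₀, …, g_p) ↦ (g_p, g₀, …, g_{p-1})`. -/
def rot {G : Type u} {p : ℕ} (g : Fin (p + 1) → G) : Fin (p + 1) → G := fun i => g (i - 1)

lemma rot_succ {G : Type u} {p : ℕ} (g : Fin (p + 1) → G) (k : Fin p) : rot g k.succ = g k.castSucc := by
  rw [rot, ← Fin.coeSucc_eq_succ, add_sub_cancel_right]

lemma rot_zero {G : Type u} {p : ℕ} (g : Fin (p + 1) → G) : rot g 0 = g (Fin.last p) := by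
  rw [rot]
  congr 1
  rw [sub_eq_iff_eq_add]
  simp

lemma rot_iterate {G : Type u} {p : ℕ} (g : Fin (p + 1) → G) : rot^[p + 1] g = g := by
  have h : ∀ k : ℕ, rot^[k] g = fun i => g (i - k • 1) := by
    intro k
    induction k with
    | zero => simp
    | succ k ih =>
      rw [Function.iterate_succ_apply', ih]
      ext i
      simp only [rot, succ_nsmul']
      congr 1
      abel
  have h1 : (p + 1) • (1 : Fin (p + 1)) = 0 := by
    simpa using card_nsmul_eq_zero (G := Fin (p + 1)) (x := 1)
  rw [h, h1]
  simp

variable {G H : Type u} [Group G] [Group H] {p q r : ℕ}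

/-- For a tuple `(g₀, …, g_p)`, the products `g₁ ⋯ g_j`, `0 ≤ j ≤ p`. -/
def base (g : Fin (p + 1) → G) : Fin (p + 1) → G := Fin.partialProd (Fin.tail g)

/-- For a tuple `(g₀, …, g_p)`, the product `g₁ ⋯ g_p g₀`. -/
def loop (g : Fin (p + 1) → G) : G := base g (Fin.last p) * g 0

/-- The action of a simplicial operator `α : [q] → [p]` on the nerve of a group:
`(a₁, …, a_p)` is sent to the tuple whose `i`-th entry is the product of the `a_j` with
`α (i - 1) < j ≤ α i`. -/
def barOp (α : Fin (q + 1) → Fin (p + 1)) (a : Fin p → G) : Fin q → G :=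
  fun i => (Fin.partialProd a (α i.castSucc))⁻¹ * Fin.partialProd a (α i.succ)

/-- The action of a simplicial operator `α : [q] → [p]` on the cyclic nerve: for `i ≥ 1` the
`i`-th entry is the product of the `g_j` with `α (i - 1) < j ≤ α i`, and the zeroth entry is
`(g_{α q + 1} ⋯ g_p) g₀ (g₁ ⋯ g_{α 0})`. -/
def cycOp (α : Fin (q + 1) → Fin (p + 1)) (g : Fin (p + 1) → G) : Fin (q + 1) → G :=
  Fin.cons ((base g (α (Fin.last q)))⁻¹ * base g (Fin.last p) * g 0 * base g (α 0))
    (barOp α (Fin.tail g))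

lemma partialProd_injective {a b : Fin p → G} (h : Fin.partialProd a = Fin.partialProd b) :
    a = b := by
  ext i
  rw [← Fin.partialProd_right_inv a, ← Fin.partialProd_right_inv b, h]

lemma partialProd_barOp (α : Fin (q + 1) → Fin (p + 1)) (a : Fin p → G) (j : Fin (q + 1)) :
    Fin.partialProd (barOp α a) j =
      (Fin.partialProd a (α 0))⁻¹ * Fin.partialProd a (α j) := by
  induction j using Fin.induction with
  | zero => simp
  | succ i ih => rw [Fin.partialProd_succ, ih, barOp]; group

lemma base_zero (g : Fin (p + 1) → G) : base g 0 = 1 := Fin.partialProd_zero _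

lemma base_cycOp (α : Fin (q + 1) → Fin (p + 1)) (g : Fin (p + 1) → G) (j : Fin (q + 1)) :
    base (cycOp α g) j = (base g (α 0))⁻¹ * base g (α j) := by
  simp only [base, cycOp, Fin.tail_cons, partialProd_barOp]

lemma loop_cycOp (α : Fin (q + 1) → Fin (p + 1)) (g : Fin (p + 1) → G) :
    loop (cycOp α g) = (base g (α 0))⁻¹ * loop g * base g (α 0) := by
  rw [loop, base_cycOp, loop, cycOp, Fin.cons_zero]
  group

lemma ext_base_loop {g g' : Fin (p + 1) → G} (h₁ : base g = base g') (h₂ : loop g = loop g') :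
    g = g' := by
  have h0 : g 0 = g' 0 := by
    rw [loop, loop, h₁] at h₂
    exact mul_left_cancel h₂
  have ht : Fin.tail g = Fin.tail g' := partialProd_injective h₁
  rw [← Fin.cons_self_tail g, ← Fin.cons_self_tail g', h0, ht]

lemma base_rot_succ (g : Fin (p + 1) → G) (k : Fin p) :
    base (rot g) k.succ = (base g (Fin.last p))⁻¹ * loop g * base g k.castSucc := by
  have h : Fin.tail (rot g) = Fin.init g := by
    ext i
    exact rot_succ g i
  rw [loop, inv_mul_cancel_left, base, h, Fin.partialProd_init, ← Fin.succ_castSucc,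
    Fin.partialProd_succ', base]

lemma loop_rot (g : Fin (p + 1) → G) :
    loop (rot g) = (base g (Fin.last p))⁻¹ * loop g * base g (Fin.last p) := by
  rw [loop, rot_zero]
  cases p with
  | zero =>
    have : (Fin.last 0) = 0 := rfl
    simp [loop, this, base_zero]
  | succ p =>
    rw [← Fin.succ_last, base_rot_succ, mul_assoc, ← Fin.succ_last]
    congr 1
    exact (Fin.partialProd_succ (Fin.tail g) (Fin.last p)).symm

lemma cycOp_id (g : Fin (p + 1) → G) : cycOp id g = g :=
  ext_base_loop (by ext j; simp [base_cycOp, base_zero]) (by simp [loop_cycOp, base_zero])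

lemma cycOp_comp (α : Fin (q + 1) → Fin (p + 1)) (β : Fin (r + 1) → Fin (q + 1))
    (g : Fin (p + 1) → G) : cycOp (α ∘ β) g = cycOp β (cycOp α g) :=
  ext_base_loop (by ext j; simp [base_cycOp]) (by simp [loop_cycOp, base_cycOp, mul_assoc])

lemma barOp_id (a : Fin p → G) : barOp id a = a :=
  partialProd_injective (by ext j; simp [partialProd_barOp])

lemma barOp_comp (α : Fin (q + 1) → Fin (p + 1)) (β : Fin (r + 1) → Fin (q + 1))
    (a : Fin p → G) : barOp (α ∘ β) a = barOp β (barOp α a) :=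
  partialProd_injective (by ext j; simp [partialProd_barOp])

lemma partialProd_comp (φ : G →* H) (a : Fin p → G) (j : Fin (p + 1)) :
    Fin.partialProd (φ ∘ a) j = φ (Fin.partialProd a j) := by
  induction j using Fin.induction with
  | zero => simp
  | succ i ih => rw [Fin.partialProd_succ, Fin.partialProd_succ, ih, map_mul]; rfl

lemma base_comp (φ : G →* H) (g : Fin (p + 1) → G) (j : Fin (p + 1)) :
    base (φ ∘ g) j = φ (base g j) := partialProd_comp φ (Fin.tail g) j

lemma loop_comp (φ : G →* H) (g : Fin (p + 1) → G) : loop (φ ∘ g) = φ (loop g) := by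
  rw [loop, loop, base_comp, map_mul]; rfl

lemma barOp_map (φ : G →* H) (α : Fin (q + 1) → Fin (p + 1)) (a : Fin p → G) :
    barOp α (φ ∘ a) = φ ∘ barOp α a :=
  partialProd_injective (by ext j; simp [partialProd_barOp, partialProd_comp])

lemma cycOp_map (φ : G →* H) (α : Fin (q + 1) → Fin (p + 1)) (g : Fin (p + 1) → G) :
    cycOp α (φ ∘ g) = φ ∘ cycOp α g :=
  ext_base_loop (by ext j; simp [base_cycOp, base_comp])
    (by simp [loop_cycOp, base_comp, loop_comp])

lemma δ_zero_rot (g : Fin (p + 1 + 1) → G) :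
    cycOp (Fin.succAbove 0) (rot g) = cycOp (Fin.succAbove (Fin.last (p + 1))) g := by
  apply ext_base_loop
  · ext j
    rw [base_cycOp, base_cycOp]
    simp only [Fin.succAbove_zero, Fin.succAbove_last, base_rot_succ]
    group
  · rw [loop_cycOp, loop_cycOp, loop_rot]
    simp only [Fin.succAbove_zero, Fin.succAbove_last, base_rot_succ, Fin.castSucc_zero, base_zero]
    group

lemma δ_succ_rot (i : Fin (p + 1)) (g : Fin (p + 1 + 1) → G) :
    cycOp (Fin.succAbove i.succ) (rot g) = rot (cycOp (Fin.succAbove i.castSucc) g) := by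
  have hl : i.castSucc.succAbove (Fin.last p) = Fin.last (p + 1) :=
    Fin.succAbove_ne_last_last (Fin.castSucc_lt_last i).ne
  have h0 : i.succ.succAbove (0 : Fin (p + 1)) = 0 :=
    Fin.succAbove_ne_zero_zero (Fin.succ_ne_zero i)
  apply ext_base_loop
  · ext j
    rw [base_cycOp, h0, base_zero, inv_one, one_mul]
    cases j using Fin.cases with
    | zero => rw [h0, base_zero, base_zero]
    | succ k =>
      rw [base_rot_succ, Fin.succ_succAbove_succ, base_rot_succ, base_cycOp, base_cycOp,
        loop_cycOp, hl, Fin.castSucc_succAbove_castSucc]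
      group
  · rw [loop_cycOp, h0, base_zero, loop_rot, loop_rot, loop_cycOp, base_cycOp, hl]
    group

lemma σ_succ_rot (i : Fin p) (g : Fin (p + 1) → G) :
    cycOp (Fin.predAbove i.succ) (rot g) =
      rot (cycOp (Fin.predAbove (i.castSucc : Fin (p + 1))) g) := by
  have hl : (i.castSucc : Fin (p + 1)).predAbove (Fin.last (p + 1)) = Fin.last p := by
    exact Fin.predAbove_right_last
  have h0 : (i.succ : Fin (p + 1)).predAbove (0 : Fin (p + 2)) = 0 := Fin.predAbove_right_zero
  apply ext_base_loop
  · ext j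
    rw [base_cycOp, h0, base_zero, inv_one, one_mul]
    cases j using Fin.cases with
    | zero => rw [h0, base_zero, base_zero]
    | succ k =>
      cases p with
      | zero => exact i.elim0
      | succ p =>
      rw [base_rot_succ, Fin.succ_predAbove_succ, base_rot_succ, base_cycOp, base_cycOp,
        loop_cycOp, hl, Fin.castSucc_predAbove_castSucc]
      group
  · rw [loop_cycOp, h0, base_zero, loop_rot, loop_rot, loop_cycOp, base_cycOp, hl]
    group

lemma σ_zero_rot (g : Fin (p + 1) → G) :
    cycOp (Fin.predAbove (0 : Fin (p + 1))) (rot g) =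
      rot (rot (cycOp (Fin.predAbove (Fin.last p)) g)) := by
  have hl : (Fin.last p).predAbove (Fin.last (p + 1)) = Fin.last p := by
    simp
  have h0 : (0 : Fin (p + 1)).predAbove (0 : Fin (p + 2)) = 0 := Fin.predAbove_right_zero
  have h0' : (Fin.last p).predAbove (0 : Fin (p + 2)) = 0 := Fin.predAbove_right_zero
  have key : base (rot (cycOp (Fin.predAbove (Fin.last p)) g)) (Fin.last (p + 1)) =
      (base g (Fin.last p))⁻¹ * loop g * base g (Fin.last p) := by
    rw [← Fin.succ_last, base_rot_succ, base_cycOp, base_cycOp, loop_cycOp, hl, h0', base_zero,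
      Fin.predAbove_castSucc_self]
    group
  have key' : loop (rot (cycOp (Fin.predAbove (Fin.last p)) g)) =
      (base g (Fin.last p))⁻¹ * loop g * base g (Fin.last p) := by
    rw [loop_rot, loop_cycOp, base_cycOp, hl, h0', base_zero]
    group
  apply ext_base_loop
  · ext j
    rw [base_cycOp, h0, base_zero, inv_one, one_mul]
    cases j using Fin.cases with
    | zero => rw [h0, base_zero, base_zero]
    | succ k =>
      rw [base_rot_succ, key, key', inv_mul_cancel, one_mul, Fin.predAbove_zero_succ]
      cases k using Fin.cases with
      | zero => rw [base_zero, Fin.castSucc_zero, base_zero]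
      | succ m =>
        rw [← Fin.succ_castSucc, base_rot_succ, base_rot_succ, base_cycOp, base_cycOp,
          loop_cycOp, hl, h0', base_zero, Fin.predAbove_last_castSucc]
        group
  · rw [loop_cycOp, h0, base_zero, loop_rot, loop_rot, key, key']
    group

/-- The faces `∂ᵢ`, `i < p`, multiply two adjacent entries. -/
lemma cycOp_face (i : Fin (p + 1)) (g : Fin (p + 1 + 1) → G) :
    cycOp (Fin.succAbove i.castSucc) g = Fin.contractNth i.castSucc (· * ·) g := by
  ext k
  cases k using Fin.cases with
  | zero =>
    rw [cycOp, Fin.cons_zero, Fin.succAbove_ne_last_last (Fin.castSucc_lt_last i).ne,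
      inv_mul_cancel, one_mul]
    cases i using Fin.cases with
    | zero =>
      rw [Fin.contractNth_apply_of_eq _ _ _ _ (by simp)]
      have h : base g (Fin.succ 0) = g 1 := by
        rw [base, Fin.partialProd_succ, Fin.castSucc_zero, Fin.partialProd_zero, one_mul]
        rfl
      rw [Fin.castSucc_zero, Fin.succAbove_zero, h]
      rfl
    | succ i =>
      rw [Fin.contractNth_apply_of_lt _ _ _ _ (by simp), Fin.castSucc_zero,
        Fin.succAbove_ne_zero_zero (by simp), base_zero, mul_one]
  | succ k =>
    cases p with
    | zero => exact k.elim0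
    | succ p =>
    rw [cycOp, Fin.cons_succ, barOp]
    cases i using Fin.cases with
    | zero =>
      rw [Fin.contractNth_apply_of_gt _ _ _ _ (by simp)]
      simp only [Fin.castSucc_zero, Fin.succAbove_zero]
      exact Fin.partialProd_right_inv (Fin.tail g) k.succ
    | succ i =>
      rw [← Fin.succ_castSucc, Fin.succ_succAbove_succ]
      refine (Fin.inv_partialProd_mul_eq_contractNth (Fin.tail g) i.castSucc k).trans ?_
      simp [Fin.contractNth, Fin.tail]

/-- The last face sends `(g₀, …, g_p)` to `(g_p g₀, g₁, …, g_{p-1})`. -/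
lemma cycOp_last_face (g : Fin (p + 1 + 1) → G) :
    cycOp (Fin.succAbove (Fin.last (p + 1))) g =
      Fin.cons (g (Fin.last (p + 1)) * g 0) (fun j => g j.succ.castSucc) := by
  ext k
  cases k using Fin.cases with
  | zero =>
    rw [cycOp, Fin.cons_zero, Fin.cons_zero, Fin.succAbove_last, Fin.castSucc_zero, base_zero,
      mul_one, ← Fin.succ_last]
    congr 1
    exact Fin.partialProd_right_inv (Fin.tail g) (Fin.last p)
  | succ k =>
    rw [cycOp, Fin.cons_succ, Fin.cons_succ, barOp, Fin.succAbove_last]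
    exact Fin.partialProd_right_inv (Fin.tail g) k.castSucc

/-- The degeneracy `sⱼ` inserts `1` behind the entry `gⱼ`. -/
lemma cycOp_degeneracy (j : Fin (p + 1)) (g : Fin (p + 1) → G) :
    cycOp (Fin.predAbove j) g = Fin.insertNth j.succ (1 : G) g := by
  rw [Fin.eq_insertNth_iff]
  refine ⟨?_, ?_⟩
  · rw [cycOp, Fin.cons_succ, barOp, Fin.predAbove_castSucc_self, Fin.predAbove_succ_self,
      inv_mul_cancel]
  · ext k
    rw [Fin.removeNth_apply]
    cases k using Fin.cases with
    | zero =>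
      rw [Fin.succ_succAbove_zero, cycOp, Fin.cons_zero, Fin.predAbove_right_last,
        Fin.predAbove_right_zero, base_zero, inv_mul_cancel, one_mul, mul_one]
    | succ m =>
      cases p with
      | zero => exact m.elim0
      | succ p =>
      rw [Fin.succ_succAbove_succ, cycOp, Fin.cons_succ, barOp]
      have h1 : j.predAbove (j.succAbove m).castSucc = m.castSucc := by
        rcases lt_or_ge m.castSucc j with h | h
        · rw [Fin.succAbove_of_castSucc_lt _ _ h, Fin.predAbove_castSucc_of_le _ _ h.le]
        · rw [Fin.succAbove_of_le_castSucc _ _ h, Fin.predAbove_castSucc_of_lt _ _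
            (lt_of_le_of_lt h Fin.castSucc_lt_succ)]
          rfl
      have h2 : j.predAbove (j.succAbove m).succ = m.succ := by
        rcases lt_or_ge m.castSucc j with h | h
        · rw [Fin.succAbove_of_castSucc_lt _ _ h, Fin.predAbove_succ_of_lt _ _ h]
          rfl
        · rw [Fin.succAbove_of_le_castSucc _ _ h, Fin.predAbove_succ_of_le _ _
            (h.trans Fin.castSucc_lt_succ.le)]
      rw [h1, h2, Fin.partialProd_right_inv]
      rfl

end CyclicNerve

open CyclicNerve

/-- The cyclic bar construction `N^{cy}(G)`, with `N^{cy}(G)_p = G^{p+1}`. -/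
def cyclicNerve (G : Type u) [Group G] : CyclicSet.{u} where
  toSSet :=
    { obj := fun n => Fin (n.unop.len + 1) → G
      map := fun α => ↾fun g => cycOp α.unop.toOrderHom g
      map_id := fun _ => ConcreteCategory.hom_ext _ _ fun g => cycOp_id g
      map_comp := fun α β => ConcreteCategory.hom_ext _ _ fun g =>
        cycOp_comp α.unop.toOrderHom β.unop.toOrderHom g }
  t _ g := rot g
  t_iterate _ g := rot_iterate g
  δ_zero_t _ g := δ_zero_rot g
  δ_succ_t _ i g := δ_succ_rot i g
  σ_zero_t _ g := σ_zero_rot g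
  σ_succ_t _ i g := σ_succ_rot i g

/-- The map `N^{cy}(G) ⟶ N^{cy}(H)` induced by a homomorphism. -/
def cyclicNerveMap {G H : Type u} [Group G] [Group H] (φ : G →* H) :
    cyclicNerve G ⟶ cyclicNerve H where
  toSSetHom :=
    { app := fun n => ↾fun g => φ ∘ (g : Fin (n.unop.len + 1) → G)
      naturality := fun _ _ α => ConcreteCategory.hom_ext _ _ fun g =>
        (cycOp_map φ α.unop.toOrderHom g).symm }
  comm _ _ := rfl

/-- The nerve `BC` of a group, with `BC_p = C^p`. -/
def bar (C : Type u) [Group C] : SSet.{u} where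
  obj := fun n => Fin n.unop.len → C
  map := fun α => ↾fun a => barOp α.unop.toOrderHom a
  map_id := fun _ => ConcreteCategory.hom_ext _ _ fun a => barOp_id a
  map_comp := fun α β => ConcreteCategory.hom_ext _ _ fun a =>
    barOp_comp α.unop.toOrderHom β.unop.toOrderHom a

namespace CyclicNerve

/-- For a homomorphism `φ : C →* G` and `y : G`, the tuple
`((φ a₁ ⋯ φ a_p)⁻¹ y, φ a₁, …, φ a_p)`. -/
def tuple {C G : Type u} [Group C] [Group G] (φ : C →* G) (y : G) {p : ℕ} (a : Fin p → C) :
    Fin (p + 1) → G :=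
  Fin.cons ((Fin.partialProd (φ ∘ a) (Fin.last p))⁻¹ * y) (φ ∘ a)

/-- The operator `[a₁, …, a_p] ↦ [z (a₁ ⋯ a_p)⁻¹, a₁, …, a_{p-1}]`. -/
def barRot {C : Type u} [Group C] (z : C) {p : ℕ} (a : Fin p → C) : Fin p → C := fun i =>
  if (i : ℕ) = 0 then z * (Fin.partialProd a (Fin.last p))⁻¹
  else a ⟨(i : ℕ) - 1, lt_of_le_of_lt (Nat.sub_le _ _) i.isLt⟩

variable {C G : Type u} [Group C] [Group G] (φ : C →* G) (y : G) {p q : ℕ}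

lemma base_tuple (a : Fin p → C) (j : Fin (p + 1)) :
    base (tuple φ y a) j = φ (Fin.partialProd a j) := by
  rw [base, tuple, Fin.tail_cons, partialProd_comp]

lemma loop_tuple (a : Fin p → C) : loop (tuple φ y a) = y := by
  rw [loop, base_tuple, tuple, Fin.cons_zero, partialProd_comp, mul_inv_cancel_left]

lemma cycOp_tuple (hy : ∀ a, φ a * y = y * φ a) (α : Fin (q + 1) → Fin (p + 1)) (a : Fin p → C) :
    cycOp α (tuple φ y a) = tuple φ y (barOp α a) :=
  ext_base_loop (by ext j; simp [base_cycOp, base_tuple, partialProd_barOp])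
    (by rw [loop_cycOp, loop_tuple, loop_tuple, base_tuple, mul_assoc, ← hy, inv_mul_cancel_left])

lemma partialProd_barRot_succ (z : C) (a : Fin p → C) (k : Fin p) :
    Fin.partialProd (barRot z a) k.succ =
      z * (Fin.partialProd a (Fin.last p))⁻¹ * Fin.partialProd a k.castSucc := by
  cases p with
  | zero => exact k.elim0
  | succ p =>
    have h : Fin.tail (barRot z a) = Fin.init a := by
      ext i
      simp [Fin.tail, barRot, Fin.init, Fin.castSucc, Fin.castAdd, Fin.castLE]
    rw [Fin.partialProd_succ', h, Fin.partialProd_init]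
    simp [barRot]

lemma tuple_barRot (hy : ∀ a, φ a * y = y * φ a) (z : C) (hz : φ z = y) (a : Fin p → C) :
    tuple φ y (barRot z a) = rot (tuple φ y a) := by
  refine ext_base_loop ?_ ?_
  · ext j
    cases j using Fin.cases with
    | zero => rw [base_zero, base_zero]
    | succ k =>
      rw [base_tuple, partialProd_barRot_succ, base_rot_succ, loop_tuple, base_tuple, base_tuple,
        map_mul, map_mul, map_inv, hz, ← map_inv, ← hy]
  · rw [loop_rot, loop_tuple, loop_tuple, base_tuple, mul_assoc, ← hy, inv_mul_cancel_left]

lemma tuple_injective {φ : C →* G} (hφ : Function.Injective φ) :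
    Function.Injective (tuple φ y (p := p)) := fun a b h => by
  have := (Fin.cons_inj.mp h).2
  ext i
  exact hφ (congrFun this i)

end CyclicNerve

/-- For a homomorphism `φ : C →* G` with values in the centralizer of `y`, the simplicial map
`BC ⟶ N^{cy}(G)` sending `[a₁, …, a_p]` to `((φ a₁ ⋯ φ a_p)⁻¹ y, φ a₁, …, φ a_p)`. -/
def barToCyclicNerve {C G : Type u} [Group C] [Group G] (φ : C →* G) (y : G)
    (hy : ∀ a, φ a * y = y * φ a) : bar C ⟶ (cyclicNerve G).toSSet where
  app n := ↾fun a => tuple φ y (p := n.unop.len) a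
  naturality _ _ α := ConcreteCategory.hom_ext _ _ fun a =>
    (cycOp_tuple φ y hy α.unop.toOrderHom a).symm

/-- The twisted nerve `B(C, z)` of a group `C` and a central element `z`: the nerve of `C` with
the cyclic operator `[a₁, …, a_p] ↦ [z (a₁ ⋯ a_p)⁻¹, a₁, …, a_{p-1}]`. -/
def twistedNerve (C : Type u) [Group C] (z : C) (hz : ∀ a, a * z = z * a) : CyclicSet.{u} :=
  .ofEmbedding (cyclicNerve C) (bar C) (barToCyclicNerve (MonoidHom.id C) z hz)
    (fun _ => tuple_injective z Function.injective_id)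
    (fun _ a => barRot z a)
    (fun _ a => tuple_barRot (MonoidHom.id C) z hz z rfl a)

namespace ConjClasses

variable {G H : Type u} [Group G] [Group H]

/-- The canonical model `C_c` for the centralizer of an element of the conjugacy class `c`.
If `c ≠ ⟨1⟩`, an element of `C_c` is a family `(a_y)`, indexed by the elements `y` of `c`, with
`a_y` in the centralizer of `y`, which is compatible with all the conjugation isomorphisms between
the centralizers of the elements of `c`. If `c = ⟨1⟩`, then `C_c` is the group `G`, regarded as the
group of families indexed by the one-element set `c = {1}`. -/
def canonicalCentralizer (c : ConjClasses G) : Subgroup (c.carrier → G) where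
  carrier := {a | (∀ y : c.carrier, a y * y = y * a y) ∧
    (c ≠ 1 → ∀ (y y' : c.carrier) (h : G), (y' : G) = h⁻¹ * y * h → a y' = h⁻¹ * a y * h)}
  one_mem' := by
    refine ⟨fun y => by simp, fun _ y y' h _ => by simp⟩
  mul_mem' := by
    rintro a b ⟨ha, ha'⟩ ⟨hb, hb'⟩
    refine ⟨fun y => ?_, fun hc y y' h e => ?_⟩
    · rw [Pi.mul_apply, mul_assoc, hb, ← mul_assoc, ha, mul_assoc]
    · rw [Pi.mul_apply, Pi.mul_apply, ha' hc y y' h e, hb' hc y y' h e]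
      group
  inv_mem' := by
    rintro a ⟨ha, ha'⟩
    refine ⟨fun y => ?_, fun hc y y' h e => ?_⟩
    · rw [Pi.inv_apply, inv_mul_eq_iff_eq_mul, ← mul_assoc, ha, mul_inv_cancel_right]
    · rw [Pi.inv_apply, Pi.inv_apply, ha' hc y y' h e]
      group

/-- The evaluation `C_c → G`, `a ↦ a_y`, at an element `y` of the class `c`. -/
def evalAt (c : ConjClasses G) (y : c.carrier) : c.canonicalCentralizer →* G :=
  (Pi.evalMonoidHom (fun _ : c.carrier => G) y).comp c.canonicalCentralizer.subtype

/-- The element of `C_c` which corresponds to `y` in the centralizer of `y`, for all `y` in `c`. -/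
def canonicalElement (c : ConjClasses G) : c.canonicalCentralizer :=
  ⟨fun y => y, fun _ => rfl, fun _ _ _ _ e => e⟩

lemma evalAt_mul_comm (c : ConjClasses G) (y : c.carrier) (a : c.canonicalCentralizer) :
    c.evalAt y a * y = y * c.evalAt y a := a.2.1 y

lemma mul_canonicalElement (c : ConjClasses G) (a : c.canonicalCentralizer) :
    a * c.canonicalElement = c.canonicalElement * a := by
  apply Subtype.ext
  funext y
  exact a.2.1 y

/-- The image of an element of `c` under a homomorphism, as an element of the class `f(c)`. -/
def mapCarrier (f : G →* H) {c : ConjClasses G} (y : c.carrier) : (c.map f).carrier :=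
  ⟨f y, by
    obtain ⟨y, hy⟩ := y
    rw [mem_carrier_iff_mk_eq] at hy ⊢
    subst hy
    rfl⟩

lemma coe_eq_one_iff (c : ConjClasses G) (y : c.carrier) : (y : G) = 1 ↔ c = 1 := by
  obtain ⟨y, hy⟩ := y
  rw [mem_carrier_iff_mk_eq] at hy
  subst hy
  rw [one_eq_mk_one, mk_eq_mk_iff_isConj, isConj_comm, isConj_one_right]

lemma exists_conj {c : ConjClasses G} (y y' : c.carrier) : ∃ h : G, (y' : G) = h⁻¹ * y * h := by
  have hy := mem_carrier_iff_mk_eq.mp y.2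
  have hy' := mem_carrier_iff_mk_eq.mp y'.2
  obtain ⟨h, e⟩ := isConj_iff.mp (mk_eq_mk_iff_isConj.mp (hy.trans hy'.symm))
  exact ⟨h⁻¹, by rw [← e, inv_inv]⟩

lemma nonempty_carrier (c : ConjClasses G) : Nonempty c.carrier := by
  obtain ⟨y, hy⟩ := exists_rep c
  exact ⟨⟨y, mem_carrier_iff_mk_eq.mpr hy⟩⟩

/-- An element of `C_c` is determined by its component at one element of `c`. -/
lemma evalAt_injective (c : ConjClasses G) (y : c.carrier) : Function.Injective (c.evalAt y) := by
  intro a b h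
  apply Subtype.ext
  funext y'
  by_cases hc : c = 1
  · have : y' = y := Subtype.ext (by
      rw [(coe_eq_one_iff c y).mpr hc, (coe_eq_one_iff c y').mpr hc])
    rw [this]
    exact h
  · obtain ⟨k, e⟩ := exists_conj y y'
    rw [a.2.2 hc y y' k e, b.2.2 hc y y' k e]
    exact congrArg (fun u => k⁻¹ * u * k) h

/-- A homomorphism `f : G → H` of free groups induces a unique homomorphism `C_c → C_{f(c)}` given
on components by the restrictions `C_y → C_{f(y)}` of `f`. -/
lemma existsUnique_map [IsFreeGroup G] [IsFreeGroup H] (f : G →* H) (c : ConjClasses G) :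
    ∃! φ : c.canonicalCentralizer →* (c.map f).canonicalCentralizer,
      ∀ a y, (c.map f).evalAt (mapCarrier f y) (φ a) = f (c.evalAt y a) := by
  obtain ⟨y₀⟩ := nonempty_carrier c
  refine existsUnique_of_exists_of_unique ?_ ?_
  swap
  · intro φ ψ hφ hψ
    ext1 a
    exact evalAt_injective _ (mapCarrier f y₀) ((hφ a y₀).trans (hψ a y₀).symm)
  have key : ∀ a : c.canonicalCentralizer, ∃ b : (c.map f).canonicalCentralizer,
      ∀ y, (c.map f).evalAt (mapCarrier f y) b = f (c.evalAt y a) := by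
    intro a
    by_cases hfc : c.map f = 1
    · have hconst : ∀ y, f (c.evalAt y a) = f (c.evalAt y₀ a) := by
        intro y
        by_cases hc : c = 1
        · have : y = y₀ := Subtype.ext (by
            rw [(coe_eq_one_iff c y).mpr hc, (coe_eq_one_iff c y₀).mpr hc])
          rw [this]
        · have h1 : ∀ y : c.carrier, f (c.evalAt y a) = 1 := fun y =>
            FreeGroupFacts.map_eq_one f (fun h => hc ((coe_eq_one_iff c y).mp h))
              (c.evalAt_mul_comm y a) ((coe_eq_one_iff _ (mapCarrier f y)).mpr hfc)
          rw [h1, h1]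
      refine ⟨⟨fun _ => f (c.evalAt y₀ a), fun y => ?_, fun h => absurd hfc h⟩, fun y => ?_⟩
      · rw [(coe_eq_one_iff _ y).mpr hfc, one_mul, mul_one]
      · exact (hconst y).symm
    · have hc : c ≠ 1 := by
        rintro rfl
        apply hfc
        rw [one_eq_mk_one, one_eq_mk_one, ← map_one f]
        rfl
      choose k hk using fun y' : (c.map f).carrier => exists_conj (mapCarrier f y₀) y'
      have hne : f (y₀ : G) ≠ 1 := fun h => hfc ((coe_eq_one_iff _ (mapCarrier f y₀)).mp h)
      have hcomm : f (c.evalAt y₀ a) * f y₀ = f y₀ * f (c.evalAt y₀ a) := by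
        rw [← map_mul, ← map_mul, c.evalAt_mul_comm y₀ a]
      have hk' : ∀ y' : (c.map f).carrier, (y' : H) = (k y')⁻¹ * f y₀ * k y' := hk
      -- independence of the conjugating element
      have hind : ∀ u v : H, u⁻¹ * f y₀ * u = v⁻¹ * f y₀ * v →
          u⁻¹ * f (c.evalAt y₀ a) * u = v⁻¹ * f (c.evalAt y₀ a) * v := by
        intro u v h
        have h1 : (u * v⁻¹) * f y₀ = f y₀ * (u * v⁻¹) := by
          calc (u * v⁻¹) * f y₀ = u * (v⁻¹ * f y₀ * v) * v⁻¹ := by group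
            _ = u * (u⁻¹ * f y₀ * u) * v⁻¹ := by rw [h]
            _ = f y₀ * (u * v⁻¹) := by group
        have h2 := FreeGroupFacts.commute_of_commute hne hcomm h1
        calc u⁻¹ * f (c.evalAt y₀ a) * u
            = u⁻¹ * (f (c.evalAt y₀ a) * (u * v⁻¹)) * v := by group
          _ = u⁻¹ * ((u * v⁻¹) * f (c.evalAt y₀ a)) * v := by rw [h2]
          _ = v⁻¹ * f (c.evalAt y₀ a) * v := by group
      refine ⟨⟨fun y' => (k y')⁻¹ * f (c.evalAt y₀ a) * k y', fun y' => ?_,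
        fun _ y y' h e => ?_⟩, fun y => ?_⟩
      · conv_lhs => rw [hk' y']
        conv_rhs => rw [hk' y']
        calc _ = (k y')⁻¹ * (f (c.evalAt y₀ a) * f y₀) * k y' := by group
          _ = _ := by rw [hcomm]; group
      · have := hind (k y') (k y * h) (by
          rw [← hk' y', e, hk' y]; group)
        refine this.trans ?_
        group
      · obtain ⟨h, e⟩ := exists_conj y₀ y
        have h1 : c.evalAt y a = h⁻¹ * c.evalAt y₀ a * h := a.2.2 hc y₀ y h e
        have h2 := hind (k (mapCarrier f y)) (f h) (by
          rw [← hk' (mapCarrier f y)]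
          simp [mapCarrier, e])
        rw [h1, map_mul, map_mul, map_inv]
        exact h2
  choose φ hφ using key
  refine ⟨MonoidHom.mk' φ fun a b => evalAt_injective _ (mapCarrier f y₀) ?_, hφ⟩
  rw [map_mul, hφ, hφ, hφ, map_mul, map_mul]

/-- The homomorphism `C_c → C_{f(c)}` induced by a homomorphism `f` of free groups. -/
noncomputable def canonicalMap [IsFreeGroup G] [IsFreeGroup H] (f : G →* H) (c : ConjClasses G) :
    c.canonicalCentralizer →* (c.map f).canonicalCentralizer :=
  (existsUnique_map f c).choose

lemma evalAt_canonicalMap [IsFreeGroup G] [IsFreeGroup H] (f : G →* H) (c : ConjClasses G)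
    (a : c.canonicalCentralizer) (y : c.carrier) :
    (c.map f).evalAt (mapCarrier f y) (c.canonicalMap f a) = f (c.evalAt y a) :=
  (existsUnique_map f c).choose_spec.1 a y

lemma canonicalMap_canonicalElement [IsFreeGroup G] [IsFreeGroup H] (f : G →* H)
    (c : ConjClasses G) :
    c.canonicalMap f c.canonicalElement = (c.map f).canonicalElement := by
  obtain ⟨y₀⟩ := nonempty_carrier c
  exact evalAt_injective _ (mapCarrier f y₀) (evalAt_canonicalMap f c _ y₀)

end ConjClasses

open ConjClasses

lemma CyclicNerve.barRot_map {C D : Type u} [Group C] [Group D] (φ : C →* D) {z : C} {w : D}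
    (h : φ z = w) {p : ℕ} (a : Fin p → C) : φ ∘ barRot z a = barRot w (φ ∘ a) := by
  funext i
  simp only [barRot, partialProd_comp, Function.comp_apply, ← h]
  split <;> simp

/-- The map `B(C, z) ⟶ B(D, w)` induced by a homomorphism `φ` with `φ z = w`. -/
def twistedNerveMap {C D : Type u} [Group C] [Group D] {z : C} {hz : ∀ a, a * z = z * a} {w : D}
    {hw : ∀ a, a * w = w * a} (φ : C →* D) (h : φ z = w) :
    twistedNerve C z hz ⟶ twistedNerve D w hw where
  toSSetHom :=
    { app := fun n => ↾fun a => φ ∘ (a : Fin n.unop.len → C)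
      naturality := fun _ _ α => ConcreteCategory.hom_ext _ _ fun a =>
        (barOp_map φ α.unop.toOrderHom a).symm }
  comm _ a := barRot_map φ h a

/-- The summand `BC_c = B(C_c, c)`, with the cyclic structure given by the canonical element. -/
def centralizerNerve {G : Type u} [Group G] (c : ConjClasses G) : CyclicSet.{u} :=
  twistedNerve c.canonicalCentralizer c.canonicalElement c.mul_canonicalElement

/-- The disjoint union of the `BC_c` over all conjugacy classes `c` of `G`. -/
def centralizerNerves (G : Type u) [Group G] : CyclicSet.{u} :=
  .sigma fun c : ConjClasses G => centralizerNerve c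

/-- The conjugacy class of the product `g₀ g₁ ⋯ g_p`. -/
def CyclicNerve.cycClass {G : Type u} [Group G] {p : ℕ} (g : Fin (p + 1) → G) : ConjClasses G :=
  ConjClasses.mk (Fin.partialProd g (Fin.last (p + 1)))

namespace CyclicNerve

variable {G : Type u} [Group G] {p q : ℕ}

lemma cycClass_eq_mk_loop (g : Fin (p + 1) → G) : cycClass g = ConjClasses.mk (loop g) := by
  rw [cycClass, mk_eq_mk_iff_isConj, isConj_iff, ← Fin.succ_last, Fin.partialProd_succ']
  refine ⟨(g 0)⁻¹, ?_⟩
  rw [inv_inv, inv_mul_cancel_left]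
  rfl

lemma mk_conj (h x : G) : ConjClasses.mk (h⁻¹ * x * h) = ConjClasses.mk x := by
  rw [mk_eq_mk_iff_isConj, isConj_comm, isConj_iff]
  exact ⟨h⁻¹, by rw [inv_inv]⟩

lemma cycClass_cycOp (α : Fin (q + 1) → Fin (p + 1)) (g : Fin (p + 1) → G) :
    cycClass (cycOp α g) = cycClass g := by
  rw [cycClass_eq_mk_loop, cycClass_eq_mk_loop, loop_cycOp, mk_conj]

lemma cycClass_tuple {C : Type u} [Group C] (φ : C →* G) (y : G) (a : Fin p → C) :
    cycClass (tuple φ y a) = ConjClasses.mk y := by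
  rw [cycClass_eq_mk_loop, loop_tuple]

lemma cycClass_rot (g : Fin (p + 1) → G) : cycClass (rot g) = cycClass g := by
  rw [cycClass_eq_mk_loop, cycClass_eq_mk_loop, loop_rot, mk_conj]

end CyclicNerve

/-- The cyclic subset `N^{cy}(G)_c` of the tuples `(g₀, …, g_p)` with `g₀ g₁ ⋯ g_p` in `c`. -/
def cyclicNerveComponent {G : Type u} [Group G] (c : ConjClasses G) : CyclicSet.{u} :=
  let A : (cyclicNerve G).toSSet.Subcomplex :=
    { obj := fun n => {g | cycClass (p := n.unop.len) g = c}
      map := fun α g hg => (cycClass_cycOp α.unop.toOrderHom g).trans hg }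
  .ofEmbedding (cyclicNerve G) A A.ι (fun _ => Subtype.val_injective)
    (fun n g => ⟨rot (p := n) g.1, (cycClass_rot (p := n) g.1).trans g.2⟩) (fun _ _ => rfl)

/-- The inclusion `N^{cy}(G)_c ⟶ N^{cy}(G)`. -/
def cyclicNerveComponentι {G : Type u} [Group G] (c : ConjClasses G) :
    cyclicNerveComponent c ⟶ cyclicNerve G where
  toSSetHom :=
    { app := fun _ => ↾fun g => g.1
      naturality := fun _ _ _ => rfl }
  comm _ _ := rfl

lemma cyclicNerveComponent_ext {G : Type u} [Group G] {n : SimplexCategoryᵒᵖ}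
    (x x' : (CyclicSet.sigma fun c : ConjClasses G => cyclicNerveComponent c).toSSet.obj n)
    (h : x.2.1 = x'.2.1) : x = x' := by
  obtain ⟨c, g, hg⟩ := x
  obtain ⟨c', g', hg'⟩ := x'
  obtain rfl : g = g' := h
  obtain rfl : c = c' := Eq.trans (Eq.symm hg) hg'
  rfl

/-- The decomposition of `N^{cy}(G)` as the disjoint union of the `N^{cy}(G)_c`. -/
def cyclicNerveDecomposition (G : Type u) [Group G] :
    CyclicSet.sigma (fun c : ConjClasses G => cyclicNerveComponent c) ≅ cyclicNerve G where
  hom := CyclicSet.sigmaDesc fun c => cyclicNerveComponentι c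
  inv :=
    { toSSetHom :=
        { app := fun n => ↾fun g => ⟨cycClass (p := n.unop.len) g, g, rfl⟩
          naturality := fun _ _ _ => ConcreteCategory.hom_ext _ _ fun _ =>
            by refine cyclicNerveComponent_ext _ _ ?_; rfl }
      comm := fun _ _ => by refine cyclicNerveComponent_ext _ _ ?_; rfl }
  hom_inv_id := CyclicSet.hom_ext (SSet.hom_ext fun _ => ConcreteCategory.hom_ext _ _ fun _ =>
    by refine cyclicNerveComponent_ext _ _ ?_; rfl)
  inv_hom_id := rfl

/-- For `y` in the conjugacy class `c`, the map `BC_c ⟶ N^{cy}(G)_c` which sends `[a₁, …, a_p]` to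
`((a₁ ⋯ a_p)⁻¹ y, a₁, …, a_p)`, where `C_c` is identified with the centralizer of `y` by evaluation
at `y`. -/
def centralizerNerveMap {G : Type u} [Group G] (c : ConjClasses G) (y : c.carrier) :
    centralizerNerve c ⟶ cyclicNerveComponent c where
  toSSetHom :=
    { app := fun n => ↾fun a => ⟨tuple (c.evalAt y) y (p := n.unop.len) a,
        (cycClass_tuple _ _ _).trans (mem_carrier_iff_mk_eq.mp y.2)⟩
      naturality := fun _ _ α => ConcreteCategory.hom_ext _ _ fun a => Subtype.ext
        (cycOp_tuple (c.evalAt y) y (c.evalAt_mul_comm y) α.unop.toOrderHom a).symm }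
  comm _ a := Subtype.ext
    (tuple_barRot (c.evalAt y) y (c.evalAt_mul_comm y) c.canonicalElement rfl a)

/-- For a choice `b` of an element in every conjugacy class of `G`, the map
`∐ BC_c ⟶ ∐ N^{cy}(G)_c` given by the maps `BC_c ⟶ N^{cy}(G)_c` for these elements. -/
def centralizerNervesMap {G : Type u} [Group G] (b : ∀ c : ConjClasses G, c.carrier) :
    centralizerNerves G ⟶ .sigma fun c : ConjClasses G => cyclicNerveComponent c :=
  CyclicSet.sigmaMap id fun c => centralizerNerveMap c (b c)

/-- The category of free groups. -/
abbrev FreeGrp : Type (u + 1) :=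
  ObjectProperty.FullSubcategory fun G : GrpCat.{u} => IsFreeGroup G

instance (G : FreeGrp.{u}) : IsFreeGroup G.obj := G.property

/-- The functor `G ↦ N^{cy}(G)`. -/
def cyclicNerveFunctor : FreeGrp.{u} ⥤ CyclicSet.{u} where
  obj G := cyclicNerve G.obj
  map f := cyclicNerveMap f.hom.hom
  map_id _ := rfl
  map_comp _ _ := rfl

lemma centralizerNerves_ext {G : Type u} [Group G] {n : SimplexCategoryᵒᵖ}
    (x x' : (centralizerNerves G).toSSet.obj n) (y : G) (hy : y ∈ x.1.carrier)
    (hy' : y ∈ x'.1.carrier)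
    (h : ∀ i : Fin n.unop.len, x.1.evalAt ⟨y, hy⟩ (x.2 i) = x'.1.evalAt ⟨y, hy'⟩ (x'.2 i)) :
    x = x' := by
  obtain ⟨c, a⟩ := x
  obtain ⟨c', a'⟩ := x'
  obtain rfl : c = c' :=
    (mem_carrier_iff_mk_eq.mp hy).symm.trans (mem_carrier_iff_mk_eq.mp hy')
  exact congrArg (Sigma.mk c) (funext fun i => evalAt_injective c ⟨y, hy⟩ (h i))

/-- The functor `G ↦ ∐ BC_c` on free groups; a homomorphism `f` maps the summand of `c` to the
summand of `f(c)` by the homomorphism `C_c → C_{f(c)}` induced by `f`. -/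
noncomputable def centralizerNervesFunctor : FreeGrp.{u} ⥤ CyclicSet.{u} where
  obj G := centralizerNerves G.obj
  map {G H} f := CyclicSet.sigmaMap (ConjClasses.map f.hom.hom) fun c =>
    twistedNerveMap (c.canonicalMap f.hom.hom) (canonicalMap_canonicalElement f.hom.hom c)
  map_id G := by
    refine CyclicSet.hom_ext (SSet.hom_ext fun n => ConcreteCategory.hom_ext _ _ fun x => ?_)
    obtain ⟨y⟩ := nonempty_carrier x.1
    exact centralizerNerves_ext _ _ (y : G.obj) (mapCarrier (𝟙 G : G ⟶ G).hom.hom y).2 y.2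
      fun i => evalAt_canonicalMap (𝟙 G : G ⟶ G).hom.hom x.1 (x.2 i) y
  map_comp {G H K} f g := by
    refine CyclicSet.hom_ext (SSet.hom_ext fun n => ConcreteCategory.hom_ext _ _ fun x => ?_)
    obtain ⟨y⟩ := nonempty_carrier x.1
    refine centralizerNerves_ext _ _ (g.hom.hom (f.hom.hom (y : G.obj)))
      (mapCarrier (f ≫ g).hom.hom y).2 (mapCarrier g.hom.hom (mapCarrier f.hom.hom y)).2
      fun i => ?_
    refine (evalAt_canonicalMap (f ≫ g).hom.hom x.1 (x.2 i) y).trans (Eq.symm ?_)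
    refine (evalAt_canonicalMap g.hom.hom _ (x.1.canonicalMap f.hom.hom (x.2 i))
      (mapCarrier f.hom.hom y)).trans ?_
    exact congrArg g.hom.hom (evalAt_canonicalMap f.hom.hom x.1 (x.2 i) y)

/-- The standard homotopy from the identity of `N^{cy}(G)` to the map `(gᵢ) ↦ (h⁻¹ gᵢ h)`, evaluated
at a tuple `g` in `N^{cy}(G)_p` and a `p`-simplex `s : [p] → [1]` of `Δ[1]`: with `hᵢ = 1` if
`s i = 0` and `hᵢ = h` if `s i = 1`, it is the tuple `(h_{i-1}⁻¹ gᵢ hᵢ)`, indices modulo `p + 1`. -/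
def conjugationHomotopy {G : Type u} [Group G] (h : G) {p : ℕ} (g : Fin (p + 1) → G)
    (s : Fin (p + 1) → Fin 2) : Fin (p + 1) → G :=
  fun i => (if s (i - 1) = 1 then h else 1)⁻¹ * g i * (if s i = 1 then h else 1)

/-- A family `(h_c)` of elements of `H` which conjugates the images under `f` of the chosen elements
of the conjugacy classes of `G` to the chosen elements of the conjugacy classes of `H`. -/
def IsConjugating {G H : FreeGrp.{u}} (f : G ⟶ H) (b : ∀ c : ConjClasses G.obj, c.carrier)
    (b' : ∀ c : ConjClasses H.obj, c.carrier) (h : ConjClasses G.obj → H.obj) : Prop :=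
  h 1 = 1 ∧ ∀ c, (h c)⁻¹ * f.hom.hom (b c) * h c = b' (c.map f.hom.hom)

/-- The square formed by `∐ BC_c ⟶ N^{cy}(G)`, `∐ BC_d ⟶ N^{cy}(H)` and the maps induced by
`f : G ⟶ H` commutes up to canonical homotopy: conjugating families `(h_c)` exist, and for each
of them the standard homotopies from the identity of `N^{cy}(H)` to the conjugations by the `h_c`
are a homotopy from one composite to the other one. -/
def CommutesUpToCanonicalHomotopy {G H : FreeGrp.{u}} (f : G ⟶ H)
    (b : ∀ c : ConjClasses G.obj, c.carrier) (b' : ∀ c : ConjClasses H.obj, c.carrier) : Prop :=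
  (∃ h, IsConjugating f b b' h) ∧ ∀ h, IsConjugating f b b' h →
    let top : centralizerNerves G.obj ⟶ cyclicNerve H.obj :=
      centralizerNervesMap b ≫ (cyclicNerveDecomposition G.obj).hom ≫ cyclicNerveFunctor.map f
    let bottom : centralizerNerves G.obj ⟶ cyclicNerve H.obj :=
      centralizerNervesFunctor.map f ≫ centralizerNervesMap b' ≫
        (cyclicNerveDecomposition H.obj).hom
    ∃ K : SSet.Homotopy top.toSSetHom bottom.toSSetHom,
      ∀ (p : ℕ) (x : (centralizerNerves G.obj).toSSet _⦋p⦌) (s : (Δ[1] : SSet.{u}) _⦋p⦌),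
        K.h.app (op ⦋p⦌) (x, s) =
          conjugationHomotopy (h x.1) (top.toSSetHom.app (op ⦋p⦌) x) s

/-!
A tuple `(g₀, …, g_p)` is a `p`-simplex of the nerve of the groupoid given by the conjugation action
of `G` on itself; its vertices are the cyclic permutations of the product `g₁ ⋯ g_p g₀`. The
summand `N^{cy}(G)_c` belongs to the component `c` of this groupoid. Choosing for every vertex in
`c` an element which conjugates it to `y`, and moving the vertices along these elements one after
the other, contracts `N^{cy}(G)_c` onto the nerve of the full subgroupoid on `y`, i.e. of the
centralizer of `y`.

In a free group, the centralizer of an element `y ≠ 1` is infinite cyclic. So it is its own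
centralizer, whence the conjugate `h⁻¹ a h` of an element `a` of it depends only on `h⁻¹ y h`: every
such `a` extends to a unique element of `C_c`. In (3) and (4), an element `h` with
`h⁻¹ f(y) h = y'` conjugates the component at `f(y)` of an element of `C_{f(c)}` to the one at `y'`
by the definition of `C_{f(c)}`, unless `f(c) = ⟨1⟩`. In that case, `f` is trivial on `C_y` for
`y ≠ 1`: it maps a generator of this group to an element one of whose powers is `f(y) = 1`, and free
groups are torsion-free.
-/

lemma existsUnique_zpowers_eq_top_and_pow_eq {C : Type*} [Group C] [IsCyclic C]
    [IsMulTorsionFree C] {z : C} (hz : z ≠ 1) :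
    ∃! r : C, Subgroup.zpowers r = ⊤ ∧ ∃ k : ℕ, 0 < k ∧ r ^ k = z := by
  obtain ⟨r, hr⟩ := isCyclic_iff_exists_zpowers_eq_top.mp ‹IsCyclic C›
  obtain ⟨m, rfl⟩ := Subgroup.mem_zpowers_iff.mp (hr ▸ Subgroup.mem_top z)
  have hr_inj : Function.Injective fun n : ℤ => r ^ n :=
    injective_zpow_iff_not_isOfFinOrder.mpr
      (not_isOfFinOrder_of_isMulTorsionFree fun h => hz (by rw [h, one_zpow]))
  have hm : m ≠ 0 := fun h => hz (by rw [h, zpow_zero])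
  have eq_or_inv_eq : ∀ r', Subgroup.zpowers r' = ⊤ → r = r' ∨ r⁻¹ = r' := fun r' hr' =>
    (Subgroup.zpowers_eq_zpowers_iff (injective_zpow_iff_not_isOfFinOrder.mp hr_inj)).mp
      (hr.trans hr'.symm)
  have inv_pow_eq_iff : ∀ k : ℕ, r⁻¹ ^ k = r ^ m ↔ -(k : ℤ) = m := fun k => by
    rw [inv_pow, ← zpow_natCast, ← zpow_neg, hr_inj.eq_iff]
  have pow_eq_iff : ∀ k : ℕ, r ^ k = r ^ m ↔ (k : ℤ) = m := fun k => by
    rw [← zpow_natCast, hr_inj.eq_iff]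
  rcases hm.lt_or_gt with hneg | hpos
  · refine ⟨r⁻¹, ⟨by rwa [Subgroup.zpowers_inv], m.natAbs, by omega,
      (inv_pow_eq_iff _).mpr (by omega)⟩, ?_⟩
    rintro r' ⟨hr', k, -, hk⟩
    rcases eq_or_inv_eq r' hr' with rfl | rfl
    · have := (pow_eq_iff k).mp hk
      omega
    · rfl
  · refine ⟨r, ⟨hr, m.natAbs, by omega, (pow_eq_iff _).mpr (by omega)⟩, ?_⟩
    rintro r' ⟨hr', k, -, hk⟩
    rcases eq_or_inv_eq r' hr' with rfl | rfl
    · rfl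
    · have := (inv_pow_eq_iff k).mp hk
      omega

lemma centralizer_centralizer_singleton_le {G : Type*} [Group G] (y : G) :
    Subgroup.centralizer (Subgroup.centralizer {y} : Set G) ≤ Subgroup.centralizer {y} :=
  Subgroup.centralizer_le
    (Set.singleton_subset_iff.mpr (Subgroup.mem_centralizer_singleton_iff.mpr rfl))

namespace FreeGroupFacts

variable {G : Type*} [Group G] [IsFreeGroup G]

variable (G) in
lemma isMulTorsionFree : IsMulTorsionFree G :=
  (IsFreeGroup.toFreeGroup G).injective.isMulTorsionFree (IsFreeGroup.toFreeGroup G).toMonoidHom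

lemma isCyclic_centralizer {y : G} (hy : y ≠ 1) : IsCyclic (Subgroup.centralizer {y}) := by
  obtain ⟨r, hr⟩ := exists_generator_centralizer hy
  have hle : Subgroup.centralizer {y} ≤ Subgroup.zpowers r := fun a ha => by
    obtain ⟨k, hk⟩ := hr a (Subgroup.mem_centralizer_singleton_iff.mp ha)
    exact Subgroup.mem_zpowers_iff.mpr ⟨k, hk.symm⟩
  exact isCyclic_of_injective (Subgroup.inclusion hle) (Subgroup.inclusion_injective hle)

lemma centralizer_centralizer_singleton {y : G} (hy : y ≠ 1) :
    Subgroup.centralizer (Subgroup.centralizer {y} : Set G) = Subgroup.centralizer {y} := by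
  have := isCyclic_centralizer hy
  exact (centralizer_centralizer_singleton_le y).antisymm (Subgroup.le_centralizer _)

end FreeGroupFacts

open Classical in
/-- An element `h` with `h⁻¹ x h = y`, for conjugate elements `x` and `y`; it is chosen to be `1` if
`x = y`. If `x` and `y` are not conjugate, it is an unspecified element. -/
noncomputable def conjugator {G : Type*} [Group G] (x y : G) : G :=
  if x = y then 1 else Classical.epsilon fun h => h⁻¹ * x * h = y

lemma conjugator_self {G : Type*} [Group G] (x : G) : conjugator x x = 1 := if_pos rfl

lemma inv_conjugator_mul_mul {G : Type*} [Group G] {x y : G} (h : IsConj x y) :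
    (conjugator x y)⁻¹ * x * conjugator x y = y := by
  by_cases hxy : x = y
  · rw [hxy, conjugator_self, inv_one, one_mul, mul_one]
  · rw [conjugator, if_neg hxy]
    obtain ⟨k, hk⟩ := isConj_iff.mp h
    exact Classical.epsilon_spec (p := fun h => h⁻¹ * x * h = y) ⟨k⁻¹, by rwa [inv_inv]⟩

namespace CanonicalCentralizer

variable {G H : Type u} [Group G] [Group H]

lemma conj_eq_conj_of_mem_centralizer_centralizer {y a : G}
    (ha : a ∈ Subgroup.centralizer (Subgroup.centralizer {y} : Set G)) {u v : G}
    (h : u⁻¹ * y * u = v⁻¹ * y * v) : u⁻¹ * a * u = v⁻¹ * a * v := by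
  have huv : u * v⁻¹ ∈ Subgroup.centralizer {y} := by
    rw [Subgroup.mem_centralizer_singleton_iff]
    calc u * v⁻¹ * y = u * (v⁻¹ * y * v) * v⁻¹ := by group
      _ = u * (u⁻¹ * y * u) * v⁻¹ := by rw [h]
      _ = y * (u * v⁻¹) := by group
  calc u⁻¹ * a * u = u⁻¹ * (a * (u * v⁻¹)) * v := by group
    _ = u⁻¹ * (u * v⁻¹ * a) * v := by rw [Subgroup.mem_centralizer_iff.mp ha _ huv]
    _ = v⁻¹ * a * v := by group

lemma isConj_coe {c : ConjClasses G} (y y' : c.carrier) : IsConj (y : G) y' :=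
  mk_eq_mk_iff_isConj.mp
    ((mem_carrier_iff_mk_eq.mp y.2).trans (mem_carrier_iff_mk_eq.mp y'.2).symm)

lemma centralizer_centralizer_le_range_evalAt (c : ConjClasses G) (y : c.carrier) :
    Subgroup.centralizer (Subgroup.centralizer {(y : G)} : Set G) ≤ (c.evalAt y).range := by
  intro a ha
  have hay : Commute a y :=
    Subgroup.mem_centralizer_singleton_iff.mp (centralizer_centralizer_singleton_le (y : G) ha)
  have hconj := fun y' : c.carrier => inv_conjugator_mul_mul (isConj_coe y y')
  let k := fun y' : c.carrier => conjugator (y : G) y'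
  refine ⟨⟨fun y' => (k y')⁻¹ * a * k y', fun y' => ?_, fun _ y₁ y₂ h hy₂ => ?_⟩, ?_⟩
  · have := (Commute.conj_iff (k y')⁻¹).mpr hay
    rwa [inv_inv, hconj y'] at this
  · have hu : (k y₂)⁻¹ * y * k y₂ = (k y₁ * h)⁻¹ * y * (k y₁ * h) := by
      calc (k y₂)⁻¹ * y * k y₂ = h⁻¹ * y₁ * h := (hconj y₂).trans hy₂
        _ = h⁻¹ * ((k y₁)⁻¹ * y * k y₁) * h := by rw [hconj y₁]
        _ = (k y₁ * h)⁻¹ * y * (k y₁ * h) := by group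
    exact (conj_eq_conj_of_mem_centralizer_centralizer ha hu).trans (by group)
  · change (k y)⁻¹ * a * k y = a
    rw [show k y = 1 from conjugator_self _, inv_one, one_mul, mul_one]

lemma range_evalAt_le (c : ConjClasses G) (y : c.carrier) :
    (c.evalAt y).range ≤ Subgroup.centralizer {(y : G)} := by
  rintro _ ⟨a, rfl⟩
  exact Subgroup.mem_centralizer_singleton_iff.mpr (c.evalAt_mul_comm y a)

lemma range_evalAt_one (y : (1 : ConjClasses G).carrier) :
    (evalAt 1 y).range = ⊤ := by
  refine top_le_iff.mp fun a _ => ⟨⟨fun _ => a, fun y' => ?_, fun h => absurd rfl h⟩, rfl⟩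
  rw [(coe_eq_one_iff 1 y').mpr rfl, one_mul, mul_one]

lemma range_evalAt [IsFreeGroup G] (c : ConjClasses G) (y : c.carrier) :
    (c.evalAt y).range = Subgroup.centralizer {(y : G)} := by
  refine le_antisymm (range_evalAt_le c y) ?_
  by_cases hc : c = 1
  · subst hc
    exact le_top.trans (range_evalAt_one y).ge
  · have hy : (y : G) ≠ 1 := (coe_eq_one_iff c y).not.mpr hc
    exact (FreeGroupFacts.centralizer_centralizer_singleton hy).ge.trans
      (centralizer_centralizer_le_range_evalAt c y)

lemma isCyclic [IsFreeGroup G] {c : ConjClasses G} (hc : c ≠ 1) :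
    IsCyclic c.canonicalCentralizer := by
  obtain ⟨y⟩ := nonempty_carrier c
  have := FreeGroupFacts.isCyclic_centralizer ((coe_eq_one_iff c y).not.mpr hc)
  exact isCyclic_of_injective
    ((c.evalAt y).codRestrict (Subgroup.centralizer {(y : G)})
      fun a => range_evalAt_le c y ⟨a, rfl⟩)
    ((c.evalAt y).injective_codRestrict _ _ |>.mpr (evalAt_injective c y))

lemma existsUnique_root [IsFreeGroup G] {c : ConjClasses G} (hc : c ≠ 1) :
    ∃! r : c.canonicalCentralizer, ∀ y : c.carrier,
      Subgroup.zpowers (c.evalAt y r) = Subgroup.centralizer {(y : G)} ∧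
        ∃ k : ℕ, 0 < k ∧ c.evalAt y r ^ k = y := by
  obtain ⟨y₀⟩ := nonempty_carrier c
  have : Nonempty c.carrier := ⟨y₀⟩
  have := isCyclic hc
  have := FreeGroupFacts.isMulTorsionFree G
  have : IsMulTorsionFree c.canonicalCentralizer :=
    (evalAt_injective c y₀).isMulTorsionFree (c.evalAt y₀)
  have zpowers_iff : ∀ (y : c.carrier) r,
      Subgroup.zpowers (c.evalAt y r) = Subgroup.centralizer {(y : G)} ↔
        Subgroup.zpowers r = ⊤ := fun y r => by
    rw [← range_evalAt, ← MonoidHom.map_zpowers, MonoidHom.range_eq_map,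
      (Subgroup.map_injective (evalAt_injective c y)).eq_iff]
  have pow_iff : ∀ (y : c.carrier) r (k : ℕ),
      c.evalAt y r ^ k = y ↔ r ^ k = c.canonicalElement := fun y r k => by
    rw [← map_pow, ← (evalAt_injective c y).eq_iff]
    rfl
  have hne : c.canonicalElement ≠ 1 := fun h =>
    hc ((coe_eq_one_iff c y₀).mp (congrArg (c.evalAt y₀) h))
  simpa only [zpowers_iff, pow_iff, forall_const] using
    existsUnique_zpowers_eq_top_and_pow_eq hne

lemma evalAt_canonicalMap_eq_conj [IsFreeGroup G] [IsFreeGroup H] (f : G →* H) (c : ConjClasses G)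
    (y : c.carrier) (y' : (c.map f).carrier) {h : H} (hy' : h⁻¹ * f y * h = y')
    (h_one : c = 1 → h = 1) (a : c.canonicalCentralizer) :
    (c.map f).evalAt y' (c.canonicalMap f a) = h⁻¹ * f (c.evalAt y a) * h := by
  rw [← evalAt_canonicalMap]
  by_cases hfc : c.map f = 1
  · have hfy : f y = 1 := (coe_eq_one_iff _ (mapCarrier f y)).mpr hfc
    obtain rfl : y' = mapCarrier f y :=
      Subtype.ext (((coe_eq_one_iff _ y').mpr hfc).trans hfy.symm)
    by_cases hc : c = 1
    · rw [h_one hc, inv_one, one_mul, mul_one]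
    · have hy : (y : G) ≠ 1 := (coe_eq_one_iff c y).not.mpr hc
      rw [evalAt_canonicalMap, FreeGroupFacts.map_eq_one f hy (c.evalAt_mul_comm y a) hfy,
        mul_one, inv_mul_cancel]
  · exact (c.canonicalMap f a).2.2 hfc (mapCarrier f y) y' h hy'.symm

end CanonicalCentralizer

namespace CyclicNerve

section Twist

variable {G : Type u} [Group G] {p q : ℕ}

/-- The tuple `(κ_{i-1}⁻¹ gᵢ κᵢ)`, indices modulo `p + 1`. It is obtained from the simplex `g` of
the nerve of the action groupoid of `G` on itself by moving the `i`-th vertex along `κᵢ`. -/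
def twist (κ g : Fin (p + 1) → G) : Fin (p + 1) → G := fun i => (κ (i - 1))⁻¹ * g i * κ i

lemma twist_one (g : Fin (p + 1) → G) : twist (fun _ => 1) g = g := by
  ext i
  simp only [twist, inv_one, one_mul, mul_one]

lemma base_twist (κ g : Fin (p + 1) → G) (j : Fin (p + 1)) :
    base (twist κ g) j = (κ 0)⁻¹ * base g j * κ j := by
  induction j using Fin.induction with
  | zero => rw [base_zero, base_zero, mul_one, inv_mul_cancel]
  | succ i ih =>
    have succ_sub_one : i.succ - 1 = i.castSucc := by
      rw [← Fin.coeSucc_eq_succ, add_sub_cancel_right]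
    rw [base, base] at *
    rw [Fin.partialProd_succ, ih, Fin.partialProd_succ, Fin.tail, twist, succ_sub_one, Fin.tail]
    group

lemma loop_twist (κ g : Fin (p + 1) → G) : loop (twist κ g) = (κ 0)⁻¹ * loop g * κ 0 := by
  have zero_sub_one : (0 : Fin (p + 1)) - 1 = Fin.last p := by
    rw [sub_eq_iff_eq_add, Fin.last_add_one]
  rw [loop, base_twist, twist, zero_sub_one, loop]
  group

lemma cycOp_twist (α : Fin (q + 1) → Fin (p + 1)) (κ g : Fin (p + 1) → G) :
    cycOp α (twist κ g) = twist (κ ∘ α) (cycOp α g) :=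
  ext_base_loop
    (by ext j; simp only [base_cycOp, base_twist, Function.comp_apply]; group)
    (by simp only [loop_cycOp, base_twist, loop_twist, Function.comp_apply]; group)

lemma cycClass_twist (κ g : Fin (p + 1) → G) : cycClass (twist κ g) = cycClass g := by
  rw [cycClass_eq_mk_loop, cycClass_eq_mk_loop, loop_twist, mk_conj]

/-- The homotopy from the identity to `twist κ`, evaluated at a tuple `g` and a simplex
`s : [p] → [1]`: only the vertices `j` with `s j = 1` are moved. -/
def partialTwist (κ g : Fin (p + 1) → G) (s : Fin (p + 1) → Fin 2) : Fin (p + 1) → G :=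
  twist (fun j => if s j = 1 then κ j else 1) g

lemma partialTwist_zero (κ g : Fin (p + 1) → G) : partialTwist κ g (fun _ => 0) = g :=
  twist_one g

lemma partialTwist_one (κ g : Fin (p + 1) → G) : partialTwist κ g (fun _ => 1) = twist κ g := rfl

lemma cycOp_partialTwist (α : Fin (q + 1) → Fin (p + 1)) (κ g : Fin (p + 1) → G)
    (s : Fin (p + 1) → Fin 2) :
    cycOp α (partialTwist κ g s) = partialTwist (κ ∘ α) (cycOp α g) (s ∘ α) :=
  cycOp_twist α _ g

lemma cycClass_partialTwist (κ g : Fin (p + 1) → G) (s : Fin (p + 1) → Fin 2) :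
    cycClass (partialTwist κ g s) = cycClass g :=
  cycClass_twist _ g

end Twist

section Vertex

variable {C G : Type u} [Group C] [Group G] {p q : ℕ}

/-- The vertices of the tuple `g`, regarded as a `p`-simplex of the nerve of the groupoid given by
the conjugation action of `G` on itself. -/
def vertex (g : Fin (p + 1) → G) (j : Fin (p + 1)) : G := (base g j)⁻¹ * loop g * base g j

lemma vertex_cycOp (α : Fin (q + 1) → Fin (p + 1)) (g : Fin (p + 1) → G) :
    vertex (cycOp α g) = vertex g ∘ α := by
  ext j
  rw [Function.comp_apply, vertex, vertex, base_cycOp, loop_cycOp]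
  group

lemma vertex_twist (κ g : Fin (p + 1) → G) (j : Fin (p + 1)) :
    vertex (twist κ g) j = (κ j)⁻¹ * vertex g j * κ j := by
  rw [vertex, vertex, base_twist, loop_twist]
  group

lemma mk_vertex (g : Fin (p + 1) → G) (j : Fin (p + 1)) :
    ConjClasses.mk (vertex g j) = cycClass g := by
  rw [vertex, mk_conj, cycClass_eq_mk_loop]

lemma vertex_tuple {φ : C →* G} {y : G} (hy : ∀ a, φ a * y = y * φ a) (a : Fin p → C)
    (j : Fin (p + 1)) : vertex (tuple φ y a) j = y := by
  rw [vertex, base_tuple, loop_tuple, mul_assoc, ← hy, inv_mul_cancel_left]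

lemma exists_tuple_eq {φ : C →* G} {y : G} (hφ : Subgroup.centralizer {y} ≤ φ.range)
    {g : Fin (p + 1) → G} (hg : ∀ j, vertex g j = y) : ∃ a : Fin p → C, tuple φ y a = g := by
  have hloop : loop g = y := by
    simpa only [vertex, base_zero, inv_one, one_mul, mul_one] using hg 0
  have hbase : ∀ j, base g j ∈ Subgroup.centralizer {y} := fun j => by
    have hj := hg j
    rw [vertex, hloop, mul_assoc, inv_mul_eq_iff_eq_mul] at hj
    exact Subgroup.mem_centralizer_singleton_iff.mpr hj.symm
  have hmem : ∀ i, Fin.tail g i ∈ φ.range := fun i => by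
    rw [← Fin.partialProd_right_inv (Fin.tail g) i]
    exact hφ (mul_mem (inv_mem (hbase i.castSucc)) (hbase i.succ))
  choose a ha using hmem
  refine ⟨a, ext_base_loop ?_ ((loop_tuple φ y a).trans hloop.symm)⟩
  rw [base, base, tuple, Fin.tail_cons]
  exact congrArg Fin.partialProd (funext ha)

end Vertex

end CyclicNerve

/-- The homotopy from `f` to `g` with the values `h` on the pairs of a simplex of `X` and a simplex
`[p] → [1]` of `Δ[1]`. -/
def homotopyOfFamily {X Y : SSet.{u}} {f g : X ⟶ Y}
    (h : ∀ n : SimplexCategoryᵒᵖ, X.obj n → (Fin (n.unop.len + 1) → Fin 2) → Y.obj n)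
    (map_h : ∀ (m n : SimplexCategoryᵒᵖ) (α : m ⟶ n) (x : X.obj m)
      (s : Fin (m.unop.len + 1) → Fin 2),
      Y.map α (h m x s) = h n (X.map α x) (s ∘ α.unop.toOrderHom))
    (h_zero : ∀ n x, h n x (fun _ => 0) = f.app n x)
    (h_one : ∀ n x, h n x (fun _ => 1) = g.app n x) : SSet.Homotopy f g where
  h :=
    { app := fun n => ↾fun x => h n x.1 (fun j => (SSet.stdSimplex.objEquiv x.2).toOrderHom j)
      naturality := fun m n α => ConcreteCategory.hom_ext _ _ fun x => (map_h m n α x.1 _).symm }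
  h₀ := SSet.hom_ext fun n => ConcreteCategory.hom_ext _ _ fun x => h_zero n x
  h₁ := SSet.hom_ext fun n => ConcreteCategory.hom_ext _ _ fun x => h_one n x
  rel := by ext _ ⟨⟨_, ⟨⟩⟩, _⟩

/-- The data exhibiting `i : X ⟶ Y` as the inclusion of a deformation retract of simplicial
sets. -/
structure DeformationRetract {X Y : SSet.{u}} (i : X ⟶ Y) where
  r : Y ⟶ X
  i_r : i ≫ r = 𝟙 X
  homotopy : SSet.Homotopy (𝟙 Y) (r ≫ i)

namespace DeformationRetract

variable {X Y : SSet.{u}} {i : X ⟶ Y}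

lemma mono (D : DeformationRetract i) : Mono i := by
  have : Mono (i ≫ D.r) := D.i_r ▸ inferInstance
  exact mono_of_mono i D.r

lemma isWeakEquivalence (D : DeformationRetract i) : IsWeakEquivalence i := by
  intro K _
  refine Function.bijective_iff_has_inverse.mpr ⟨HomotopyClasses.precomp D.r K, ?_, ?_⟩
  · rintro ⟨g⟩
    exact Eq.symm (Quot.sound
      ⟨D.homotopy.postcomp (SSet.RelativeMorphism.botEquiv.symm g) (by ext _ ⟨_, ⟨⟩⟩)⟩)
  · rintro ⟨g⟩
    change Quot.mk _ (i ≫ D.r ≫ g) = Quot.mk _ g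
    rw [reassoc_of% D.i_r]

/-- The deformation retract given by a homotopy from the identity of `Y` to a map `e` with values
in the image of `i` which restricts to the identity on it. -/
noncomputable def ofMono [Mono i] {e : Y ⟶ Y} (H : SSet.Homotopy (𝟙 Y) e)
    (he : SSet.Subcomplex.range e ≤ SSet.Subcomplex.range i) (hi : i ≫ e = i) :
    DeformationRetract i :=
  let r : Y ⟶ X := SSet.Subcomplex.lift e he ≫ inv (SSet.Subcomplex.toRange i)
  have inv_toRange_comp : inv (SSet.Subcomplex.toRange i) ≫ i = (SSet.Subcomplex.range i).ι :=
    (IsIso.inv_comp_eq _).mpr (SSet.Subcomplex.toRange_ι i).symm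
  have r_i : r ≫ i = e := by
    rw [Category.assoc, inv_toRange_comp, SSet.Subcomplex.lift_ι]
  { r := r
    i_r := by rw [← cancel_mono i, Category.assoc, r_i, hi, Category.id_comp]
    homotopy := r_i ▸ H }

/-- A disjoint union of deformation retracts. -/
def sigma {ι : Type u} {X Y : ι → CyclicSet.{u}} {f : ∀ c, X c ⟶ Y c}
    (D : ∀ c, DeformationRetract (f c).toSSetHom) :
    DeformationRetract (CyclicSet.sigmaMap id f).toSSetHom where
  r :=
    { app := fun n => ↾fun y => ⟨y.1, (D y.1).r.app n y.2⟩
      naturality := fun _ _ α => ConcreteCategory.hom_ext _ _ fun y =>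
        congrArg (Sigma.mk y.1) (ConcreteCategory.congr_hom ((D y.1).r.naturality α) y.2) }
  i_r := SSet.hom_ext fun n => ConcreteCategory.hom_ext _ _ fun x =>
    congrArg (Sigma.mk x.1) (ConcreteCategory.congr_hom (NatTrans.congr_app (D x.1).i_r n) x.2)
  homotopy :=
    { h :=
        { app := fun n => ↾fun y : (Σ c, (Y c).toSSet.obj n) × (Δ[1] : SSet.{u}).obj n =>
            ⟨y.1.1, (D y.1.1).homotopy.h.app n (y.1.2, y.2)⟩
          naturality := fun m n α => ConcreteCategory.hom_ext _ _
            fun y : (Σ c, (Y c).toSSet.obj m) × (Δ[1] : SSet.{u}).obj m =>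
              congrArg (Sigma.mk y.1.1) (NatTrans.naturality_apply (D y.1.1).homotopy.h α
                (show ((Y y.1.1).toSSet ⊗ Δ[1]).obj m from (y.1.2, y.2))) }
      h₀ := SSet.hom_ext fun n => ConcreteCategory.hom_ext _ _ fun y =>
        congrArg (Sigma.mk y.1) (ConcreteCategory.congr_hom
          (NatTrans.congr_app (D y.1).homotopy.h₀ n) y.2)
      h₁ := SSet.hom_ext fun n => ConcreteCategory.hom_ext _ _ fun y =>
        congrArg (Sigma.mk y.1) (ConcreteCategory.congr_hom
          (NatTrans.congr_app (D y.1).homotopy.h₁ n) y.2)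
      rel := by ext _ ⟨⟨_, ⟨⟩⟩, _⟩ }

end DeformationRetract

namespace CyclicNerve

variable {G : Type u} [Group G] (c : ConjClasses G) (y : c.carrier)

instance mono_centralizerNerveMap : Mono (centralizerNerveMap c y).toSSetHom :=
  (NatTrans.mono_iff_mono_app _).mpr fun _ => (CategoryTheory.mono_iff_injective _).mpr
    fun _ _ h => tuple_injective (y : G) (evalAt_injective c y) (congrArg Subtype.val h)

/-- The endomorphism of `N^{cy}(G)_c` which moves all vertices of a simplex to `y`. -/
noncomputable def contraction :
    (cyclicNerveComponent c).toSSet ⟶ (cyclicNerveComponent c).toSSet where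
  app n := ↾fun g => ⟨twist (p := n.unop.len) ((conjugator · (y : G)) ∘ vertex g.1) g.1,
    (cycClass_twist _ _).trans g.2⟩
  naturality _ _ α := ConcreteCategory.hom_ext _ _ fun g => Subtype.ext <| by
    refine Eq.trans ?_ (cycOp_twist α.unop.toOrderHom _ g.1).symm
    exact congrArg (fun v => twist ((conjugator · (y : G)) ∘ v) (cycOp α.unop.toOrderHom g.1))
      (vertex_cycOp α.unop.toOrderHom g.1)

/-- The homotopy from the identity to `contraction c y` which moves the vertices one by one. -/
noncomputable def contractionHomotopy : SSet.Homotopy (𝟙 _) (contraction c y) :=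
  homotopyOfFamily
    (fun n g s => ⟨partialTwist (p := n.unop.len) ((conjugator · (y : G)) ∘ vertex g.1) g.1 s,
      (cycClass_partialTwist _ _ _).trans g.2⟩)
    (fun _ _ α g s => Subtype.ext <| by
      refine (cycOp_partialTwist α.unop.toOrderHom _ g.1 s).trans ?_
      exact congrArg (fun v => partialTwist ((conjugator · (y : G)) ∘ v)
        (cycOp α.unop.toOrderHom g.1) (s ∘ α.unop.toOrderHom))
          (vertex_cycOp α.unop.toOrderHom g.1).symm)
    (fun _ g => Subtype.ext (partialTwist_zero _ g.1))
    (fun _ g => Subtype.ext (partialTwist_one _ g.1))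

lemma range_contraction_le (hy : Subgroup.centralizer {(y : G)} ≤ (c.evalAt y).range) :
    SSet.Subcomplex.range (contraction c y) ≤
      SSet.Subcomplex.range (centralizerNerveMap c y).toSSetHom := by
  rintro n _ ⟨g, rfl⟩
  have vertex_isConj : ∀ j, IsConj (vertex (p := n.unop.len) g.1 j) y := fun j =>
    mk_eq_mk_iff_isConj.mp
      (((mk_vertex g.1 j).trans g.2).trans (mem_carrier_iff_mk_eq.mp y.2).symm)
  obtain ⟨a, ha⟩ := exists_tuple_eq (p := n.unop.len) hy fun j =>
    (vertex_twist _ g.1 j).trans (inv_conjugator_mul_mul (vertex_isConj j))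
  exact ⟨a, Subtype.ext ha⟩

lemma centralizerNerveMap_contraction :
    (centralizerNerveMap c y).toSSetHom ≫ contraction c y =
      (centralizerNerveMap c y).toSSetHom := by
  have twist_tuple : ∀ {p : ℕ} (a : Fin p → c.canonicalCentralizer),
      twist ((conjugator · (y : G)) ∘ vertex (tuple (c.evalAt y) y a)) (tuple (c.evalAt y) y a) =
        tuple (c.evalAt y) y a := fun a => by
    simp only [Function.comp_def, vertex_tuple (c.evalAt_mul_comm y), conjugator_self, twist_one]
  exact SSet.hom_ext fun n => ConcreteCategory.hom_ext _ _ fun a =>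
    Subtype.ext (twist_tuple (p := n.unop.len) a)

/-- The nerve of the canonical centralizer of `c` as a deformation retract of `N^{cy}(G)_c`. -/
noncomputable def centralizerNerveDeformationRetract
    (hy : Subgroup.centralizer {(y : G)} ≤ (c.evalAt y).range) :
    DeformationRetract (centralizerNerveMap c y).toSSetHom :=
  .ofMono (contractionHomotopy c y) (range_contraction_le c y hy)
    (centralizerNerveMap_contraction c y)

end CyclicNerve

section Naturality

/-- The homotopy given by the standard homotopies from the identity of `N^{cy}(G)` to conjugation by
elements `k x` of `G` which depend only on the connected component of the simplex `x`. -/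
def homotopyOfConjugation {X : SSet.{u}} {G : Type u} [Group G]
    {φ ψ : X ⟶ (cyclicNerve G).toSSet} (k : ∀ n, X.obj n → G)
    (hk : ∀ (m n : SimplexCategoryᵒᵖ) (α : m ⟶ n) (x : X.obj m), k n (X.map α x) = k m x)
    (hψ : ∀ (n : SimplexCategoryᵒᵖ) (x : X.obj n),
      twist (p := n.unop.len) (fun _ => k n x) (φ.app n x) = ψ.app n x) : SSet.Homotopy φ ψ :=
  homotopyOfFamily
    (fun n x s => conjugationHomotopy (p := n.unop.len) (k n x) (φ.app n x) s)
    (fun m n α x s => (cycOp_partialTwist α.unop.toOrderHom (fun _ => k m x) (φ.app m x) s).trans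
      (congrArg₂ (fun h g => conjugationHomotopy h g (s ∘ α.unop.toOrderHom)) (hk m n α x).symm
        (NatTrans.naturality_apply φ α x).symm))
    (fun n _ => partialTwist_zero (p := n.unop.len) _ _)
    hψ

variable {G H : FreeGrp.{u}} (f : G ⟶ H) (b : ∀ c : ConjClasses G.obj, c.carrier)
  (b' : ∀ c : ConjClasses H.obj, c.carrier)

lemma exists_isConjugating : ∃ h, IsConjugating f b b' h := by
  refine ⟨fun c => conjugator (f.hom.hom (b c)) (b' (c.map f.hom.hom) : H.obj), ?_, fun c =>
    inv_conjugator_mul_mul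
      (CanonicalCentralizer.isConj_coe (mapCarrier f.hom.hom (b c)) (b' _))⟩
  have hb : f.hom.hom (b 1 : G.obj) = 1 := by rw [(coe_eq_one_iff 1 (b 1)).mpr rfl, map_one]
  have hb' : (b' ((1 : ConjClasses G.obj).map f.hom.hom) : H.obj) = 1 :=
    (coe_eq_one_iff _ _).mpr ((coe_eq_one_iff _ (mapCarrier f.hom.hom (b 1))).mp hb)
  exact (congrArg₂ conjugator hb hb').trans (conjugator_self 1)

variable {f b b'}

lemma twist_comp_tuple {h : ConjClasses G.obj → H.obj} (hh : IsConjugating f b b' h)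
    (c : ConjClasses G.obj) {p : ℕ} (a : Fin p → c.canonicalCentralizer) :
    twist (fun _ => h c) (f.hom.hom ∘ tuple (c.evalAt (b c)) (b c) a) =
      tuple ((c.map f.hom.hom).evalAt (b' _)) (b' (c.map f.hom.hom))
        (c.canonicalMap f.hom.hom ∘ a) :=
  ext_base_loop
    (funext fun j => by
      rw [base_twist, base_comp, base_tuple, base_tuple, partialProd_comp,
        CanonicalCentralizer.evalAt_canonicalMap_eq_conj f.hom.hom c (b c) _ (hh.2 c)
          fun hc => hc ▸ hh.1])
    (by rw [loop_twist, loop_comp, loop_tuple, loop_tuple, hh.2])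

variable (f b b') in
theorem commutesUpToCanonicalHomotopy : CommutesUpToCanonicalHomotopy f b b' := by
  refine ⟨exists_isConjugating f b b', ?_⟩
  intro h hh _ _
  exact ⟨homotopyOfConjugation (fun _ x => h x.1) (fun _ _ _ _ => rfl)
    fun n x => twist_comp_tuple hh x.1 (p := n.unop.len) x.2, fun _ _ _ => rfl⟩

end Naturality

theorem mainTheorem7 (Γ : SimplicialObject FreeGrp.{u}) :
    (∀ (n : SimplexCategoryᵒᵖ) (c : ConjClasses (Γ.obj n).obj),
      (∀ y : c.carrier, Function.Injective (c.evalAt y) ∧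
        (c.evalAt y).range = Subgroup.centralizer {(y : (Γ.obj n).obj)}) ∧
      (c ≠ 1 → ∃! r : c.canonicalCentralizer, ∀ y : c.carrier,
        Subgroup.zpowers (c.evalAt y r) = Subgroup.centralizer {(y : (Γ.obj n).obj)} ∧
        ∃ k : ℕ, 0 < k ∧ c.evalAt y r ^ k = y)) ∧
    ∀ b : ∀ (n : SimplexCategoryᵒᵖ) (c : ConjClasses (Γ.obj n).obj), c.carrier,
      (∀ (n : SimplexCategoryᵒᵖ) (c : ConjClasses (Γ.obj n).obj),
        Mono (centralizerNerveMap c (b n c)).toSSetHom ∧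
        IsWeakEquivalence (centralizerNerveMap c (b n c)).toSSetHom) ∧
      (∀ n : SimplexCategoryᵒᵖ, Mono (centralizerNervesMap (b n)).toSSetHom ∧
        IsWeakEquivalence (centralizerNervesMap (b n)).toSSetHom) ∧
      (∀ (m n : SimplexCategoryᵒᵖ) (α : m ⟶ n),
        CommutesUpToCanonicalHomotopy (Γ.map α) (b m) (b n)) ∧
      (∀ (Γ' : SimplicialObject FreeGrp.{u}) (f : Γ ⟶ Γ')
        (b' : ∀ (n : SimplexCategoryᵒᵖ) (c : ConjClasses (Γ'.obj n).obj), c.carrier)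
        (n : SimplexCategoryᵒᵖ), CommutesUpToCanonicalHomotopy (f.app n) (b n) (b' n)) := by
  refine ⟨fun n c => ⟨fun y => ⟨evalAt_injective c y, CanonicalCentralizer.range_evalAt c y⟩,
    CanonicalCentralizer.existsUnique_root⟩, fun b => ?_⟩
  have D := fun n c => centralizerNerveDeformationRetract c (b n c)
    (CanonicalCentralizer.range_evalAt c (b n c)).ge
  have D_sigma := fun n => DeformationRetract.sigma (D n)
  exact ⟨fun n c => ⟨(D n c).mono, (D n c).isWeakEquivalence⟩,
    fun n => ⟨(D_sigma n).mono, (D_sigma n).isWeakEquivalence⟩,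
    fun _ _ _ => commutesUpToCanonicalHomotopy _ _ _,
    fun _ _ _ _ => commutesUpToCanonicalHomotopy _ _ _⟩
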